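/- Let $n\ge 1$ and let $\mathbb D^n=\{z\in\mathbb C^n: |z_l|<1,\ 1\le l\le n\}$. A set $K$ is Reinhardt if $z\in K$ and $|w_l|=|z_l|$ for all $l$ imply $w\in K$. Put $\mathbb R^n_-=\{s\in\mathbb R^n: s_l<0,\ 1\le l\le n\}$ and $\operatorname{Log}K=\{s\in\mathbb R^n_-: (e^{s_1},\dots,e^{s_n})\in K\}$. A compact Reinhardt set $K\subset\mathbb D^n$ is called complete logarithmically convex if $\operatorname{Log}K$ is convex, $\operatorname{Log}K+\mathbb R^n_-\subset\operatorname{Log}K$, and $K$ is determined by $\operatorname{Log}K$, i.e. the points of $K$ with no zero coordinate are dense in $K$. For $K\subset\mathbb D^n$ let $\omega_K(z)=\limsup_{y\to z}\,\sup\{u(y): u \text{ plurisubharmonic in }\mathbb D^n,\ u\le 0,\ u|_K\le -1\}$ be its relative extremal function. Let $A=\{\zeta\in\mathbb C: 0<\log|\zeta|<1\}$ and $A_j=\{\zeta: \log|\zeta|=j\}$, $j=0,1$. The geodesic between two functions $u_0,u_1$ on $\mathbb D^n$ is $u_t(z)=\sup\{u(z,e^t): u\in W\}$, $0<t<1$,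 where $W$ is the class of all plurisubharmonic functions $u$ in $\mathbb D^n\times A$ such that $\limsup_{\zeta\to A_j}u(z,\zeta)\le u_j(z)$ for all $z\in\mathbb D^n$, $j=0,1$. **Theorem.** Let $K_0,K_1\subset\mathbb D^n$ be non-pluripolar complete logarithmically convex compact Reinhardt sets, let $c_0,c_1>0$, and let $u^c_t$ be the geodesic between $c_0\,\omega_{K_0}$ and $c_1\,\omega_{K_1}$. Then for every $t\in(0,1)$ the interpolating set $$K_t^c=\{z\in\mathbb D^n: u_t^c(z)=m_t\},\qquad m_t=\min\{u_t^c(z): z\in\mathbb D^n\},$$ coincides with the geometric mean $$K_0^{1-t}K_1^t=\{z: |z_l|=|\eta_l|^{1-t}|\xi_l|^t,\ 1\le l\le n,\ \eta\in K_0,\ \xi\in K_1\}.$$ In particular, the sets $K_t^c$ do not depend on the weights $c_0,c_1$. -/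

import Mathlib

open MeasureTheory Set Filter Topology
open scoped Pointwise ENNReal

noncomputable section

/-- The mean `(1 / 2π) ∫₀^{2π} f(θ) dθ` of an extended real function, as the mean of its positive
part minus the mean of its negative part. -/
def circleMean (f : ℝ → EReal) : EReal :=
  (laverage (volume.restrict (Ioc 0 (2 * Real.pi))) fun θ => (f θ).toENNReal : ℝ≥0∞) -
    (laverage (volume.restrict (Ioc 0 (2 * Real.pi))) fun θ => (-f θ).toENNReal : ℝ≥0∞)

/-- Plurisubharmonic functions `u : U → [-∞, ∞)` on an open set `U`: upper semicontinuous functions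
with the sub-mean value property on every closed disk in `U` that lies in a complex line.
(The function that is `-∞` everywhere is admitted; values outside `U` are irrelevant.) -/
structure IsPlurisubharmonicOn {E : Type*} [NormedAddCommGroup E] [NormedSpace ℂ E]
    (u : E → EReal) (U : Set E) : Prop where
  lt_top : ∀ z ∈ U, u z < ⊤
  usc : UpperSemicontinuousOn u U
  submean : ∀ a b : E, (∀ ζ : ℂ, ‖ζ‖ ≤ 1 → a + ζ • b ∈ U) →
    u a ≤ circleMean fun θ : ℝ => u (a + Complex.exp (θ * Complex.I) • b)

/-- A set is pluripolar if some plurisubharmonic function on the whole space, not identically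
`-∞`, equals `-∞` on it. -/
def IsPluripolar {E : Type*} [NormedAddCommGroup E] [NormedSpace ℂ E] (S : Set E) : Prop :=
  ∃ u : E → EReal, IsPlurisubharmonicOn u univ ∧ (∃ z, u z ≠ ⊥) ∧ ∀ z ∈ S, u z = ⊥

/-- The open unit polydisk. -/
def unitPolydisk (n : ℕ) : Set (Fin n → ℂ) := {z | ∀ l, ‖z l‖ < 1}

/-- Reinhardt (multicircled) sets. -/
def IsReinhardt {n : ℕ} (K : Set (Fin n → ℂ)) : Prop :=
  ∀ z ∈ K, ∀ w : Fin n → ℂ, (∀ l, ‖w l‖ = ‖z l‖) → w ∈ K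

/-- The open negative orthant. -/
def negOrthant (n : ℕ) : Set (Fin n → ℝ) := {s | ∀ l, s l < 0}

/-- The logarithmic image of `K`. -/
def logImage {n : ℕ} (K : Set (Fin n → ℂ)) : Set (Fin n → ℝ) :=
  {s | s ∈ negOrthant n ∧ (fun l => (Real.exp (s l) : ℂ)) ∈ K}

/-- Complete logarithmic convexity of a set in the polydisk: the logarithmic image is a complete
convex set, and it determines the closed set `K`, that is, the points of `K` without zero
coordinates are dense in `K`. -/
structure IsCompleteLogConvex {n : ℕ} (K : Set (Fin n → ℂ)) : Prop where
  convex : Convex ℝ (logImage K)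
  complete : logImage K + negOrthant n ⊆ logImage K
  dense : K ⊆ closure {z | z ∈ K ∧ ∀ l, z l ≠ 0}

/-- The negative plurisubharmonic functions on `Ω` that are at most `-1` on `K`. -/
def extremalClass {n : ℕ} (Ω K : Set (Fin n → ℂ)) : Set ((Fin n → ℂ) → EReal) :=
  {u | IsPlurisubharmonicOn u Ω ∧ (∀ z ∈ Ω, u z ≤ 0) ∧ ∀ z ∈ K, u z ≤ -1}

/-- The relative extremal function `ω_{K,Ω}` (meaningful at points of the open set `Ω`): the upper
semicontinuous regularization of the upper envelope of the class above. -/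
def relExtremal {n : ℕ} (Ω K : Set (Fin n → ℂ)) (z : Fin n → ℂ) : EReal :=
  limsup (fun y => ⨆ u ∈ extremalClass Ω K, u y) (𝓝[Ω] z)

/-- The annulus `0 < log |ζ| < 1`. -/
def annulus : Set ℂ := {ζ | ζ ≠ 0 ∧ 0 < Real.log ‖ζ‖ ∧ Real.log ‖ζ‖ < 1}

/-- The circle `log |ζ| = j`. -/
def boundaryCircle (j : ℝ) : Set ℂ := {ζ | ζ ≠ 0 ∧ Real.log ‖ζ‖ = j}

/-- The class of all plurisubharmonic functions on `Ω ×` annulus whose boundary values over the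
two boundary circles are dominated by `u₀` and `u₁`. -/
def geodesicClass {n : ℕ} (Ω : Set (Fin n → ℂ)) (u₀ u₁ : (Fin n → ℂ) → EReal) :
    Set ((Fin n → ℂ) × ℂ → EReal) :=
  {u | IsPlurisubharmonicOn u (Ω ×ˢ annulus) ∧
    (∀ z ∈ Ω, limsup (fun ζ => u (z, ζ)) (𝓝ˢ (boundaryCircle 0) ⊓ 𝓟 annulus) ≤ u₀ z) ∧
    (∀ z ∈ Ω, limsup (fun ζ => u (z, ζ)) (𝓝ˢ (boundaryCircle 1) ⊓ 𝓟 annulus) ≤ u₁ z)}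

/-- The geodesic `u_t` between `u₀` and `u₁`: the upper envelope of the class above at `ζ = e^t`. -/
def geodesic {n : ℕ} (Ω : Set (Fin n → ℂ)) (u₀ u₁ : (Fin n → ℂ) → EReal) (t : ℝ)
    (z : Fin n → ℂ) : EReal :=
  ⨆ u ∈ geodesicClass Ω u₀ u₁, u (z, (Real.exp t : ℂ))

/-- The geodesic between the weighted relative extremal functions `c₀ ω_{K₀}` and `c₁ ω_{K₁}`. -/
def weightedGeodesic {n : ℕ} (Ω K₀ K₁ : Set (Fin n → ℂ)) (c₀ c₁ t : ℝ) :
    (Fin n → ℂ) → EReal :=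
  geodesic Ω (fun z => (c₀ : EReal) * relExtremal Ω K₀ z)
    (fun z => (c₁ : EReal) * relExtremal Ω K₁ z) t

/-- The interpolating set: the points of `Ω` at which the weighted geodesic attains its minimum
over `Ω`. -/
def interpolatingSet {n : ℕ} (Ω K₀ K₁ : Set (Fin n → ℂ)) (c₀ c₁ t : ℝ) : Set (Fin n → ℂ) :=
  {z | z ∈ Ω ∧ weightedGeodesic Ω K₀ K₁ c₀ c₁ t z = ⨅ w ∈ Ω, weightedGeodesic Ω K₀ K₁ c₀ c₁ t w}

/-- The geometric mean `K₀^{1-t} K₁^t`. -/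
def geometricMean {n : ℕ} (K₀ K₁ : Set (Fin n → ℂ)) (t : ℝ) : Set (Fin n → ℂ) :=
  {z | ∃ η ∈ K₀, ∃ ξ ∈ K₁, ∀ l, ‖z l‖ = ‖η l‖ ^ (1 - t) * ‖ξ l‖ ^ t}

end

/-! The minimum is `m = -((1 - t) c₀ + t c₁)`, and the set where it is attained is found by bounding
the geodesic from both sides.

Lower bounds come from explicit members of the class. If `α ≥ 0`, `∏ |z_l|^{α_l} ≤ e^{A_j}` on `K_j`
and `-A_j ≤ c_j`, then `log ∏ |z_l|^{α_l}` plus the affine function of `log |ζ|` with end values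
`-A_j - c_j` is admissible (`le_weightedGeodesic`). With `α = 0` this gives `u_t ≥ m` everywhere. A
point outside the geometric mean is separated from it, in logarithmic coordinates, by a hyperplane
with normal `α ≥ 0` (`exists_separating_monomial`); a small multiple of that monomial gives `u_t >
m` there.

For the upper bound on the geometric mean, let `|z_l| = |η_l|^{1-t} |ξ_l|^t`. Then `(z, e^t)` lies
on the real surface `|z_l| = |η_l|^{1-x} |ξ_l|^x`, `x = log |ζ|`, which joins `K₀` to `K₁` and is
foliated by multivalued holomorphic curves `z_l = C_l ζ^{a_l}`. The maximum principle along these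
leaves would give `u ≤ -(1-x) c₀ - x c₁`. The submean property is given on affine disks only, so
leaves are replaced by tangent disks, which leave the surface to second order. A compact tube around
the surface and a strictly supermean comparison function absorb the error (`exists_disk_logTube`,
`lt_of_strictly_supermean`, `le_of_mem_geodesicClass_of_mem_geometricMean`). Near the ends of the
tube, `u` is controlled by `exists_relExtremal_le` and `le_interpolation_of_mem_geodesicClass`. -/

/-! ### Circle means, a maximum principle and logarithmic plurisubharmonic functions. -/

theorem circleMean_mono_ae {f g : ℝ → EReal}
    (h : f ≤ᵐ[volume.restrict (Ioc 0 (2 * Real.pi))] g) : circleMean f ≤ circleMean g := by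
  unfold circleMean
  apply EReal.sub_le_sub
  · exact_mod_cast laverage_mono_ae (h.mono fun θ hθ => EReal.toENNReal_le_toENNReal hθ)
  · exact_mod_cast laverage_mono_ae
      (h.mono fun θ hθ => EReal.toENNReal_le_toENNReal (EReal.neg_le_neg_iff.2 hθ))

theorem circleMean_coe {g : ℂ → ℝ} (hg : CircleIntegrable g 0 1) :
    circleMean (fun θ : ℝ => (g (Complex.exp (θ * Complex.I)) : EReal)) =
      (Real.circleAverage g 0 1 : ℝ) := by
  have h2 : (0 : ℝ) ≤ 2 * Real.pi := by positivity
  have hv : (volume.restrict (Ioc 0 (2 * Real.pi))) univ = ENNReal.ofReal (2 * Real.pi) := by simp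
  have hi : Integrable (fun θ : ℝ => g (Complex.exp (θ * Complex.I)))
      (volume.restrict (Ioc 0 (2 * Real.pi))) := by
    have := (intervalIntegrable_iff_integrableOn_Ioc_of_le h2).1 hg
    simpa [circleMap, IntegrableOn] using this
  have key : ∀ f : ℝ → ℝ, Integrable f (volume.restrict (Ioc 0 (2 * Real.pi))) →
      ((laverage (volume.restrict (Ioc 0 (2 * Real.pi))) fun θ => ENNReal.ofReal (f θ) : ℝ≥0∞)
        : EReal) = (((2 * Real.pi)⁻¹ *
          (∫⁻ θ in Ioc 0 (2 * Real.pi), ENNReal.ofReal (f θ)).toReal : ℝ) : EReal) := by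
    intro f hf
    rw [laverage_eq, hv]
    have hfin : (∫⁻ θ in Ioc 0 (2 * Real.pi), ENNReal.ofReal (f θ)) ≠ ∞ :=
      hf.lintegral_lt_top.ne
    have h3 : (∫⁻ θ in Ioc 0 (2 * Real.pi), ENNReal.ofReal (f θ)) / ENNReal.ofReal (2 * Real.pi)
        ≠ ∞ := ENNReal.div_ne_top hfin (by simp [Real.pi_pos])
    rw [← EReal.coe_ennreal_toReal h3, ENNReal.toReal_div, ENNReal.toReal_ofReal h2, div_eq_inv_mul]
  unfold circleMean
  simp only [← EReal.coe_neg, EReal.toENNReal_of_ne_top (EReal.coe_ne_top _), EReal.toReal_coe]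
  have h1 := key _ hi.neg
  simp only [Pi.neg_apply] at h1
  rw [key _ hi, h1, ← EReal.coe_sub, Real.circleAverage_def,
    intervalIntegral.integral_of_le h2]
  simp only [circleMap, zero_add, Complex.ofReal_one, one_mul, smul_eq_mul]
  rw [integral_eq_lintegral_pos_part_sub_lintegral_neg_part hi, mul_sub]

theorem circleAverage_const_mul (r : ℝ) (f : ℂ → ℝ) (c : ℂ) (R : ℝ) :
    Real.circleAverage (fun ζ => r * f ζ) c R = r * Real.circleAverage f c R := by
  simpa only [smul_eq_mul] using Real.circleAverage_fun_smul (𝕜 := ℝ) (a := r) (f := f)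

/-- Jensen's formula for a linear function, after a rotation making the coefficient of `ζ` positive.
The case `d = 0` is split off because `Real.log 0 = 0` falsifies the maximum when `‖c‖ < 1`. -/
theorem circleAverage_log_norm_add_mul {c : ℂ} (hc : c ≠ 0) (d : ℂ) :
    Real.circleAverage (fun ζ => Real.log ‖c + ζ * d‖) 0 1 = max (Real.log ‖d‖) (Real.log ‖c‖) ∨
      d = 0 := by
  by_cases hd : d = 0
  · exact Or.inr hd
  left
  have hR : ‖d‖ ≠ 0 := norm_ne_zero_iff.2 hd
  have h := circleAverage_log_norm_sub_const_eq_log_radius_add_posLog (a := 0)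
    (c := c * (‖d‖ / d)) hR
  rw [Real.circleAverage_eq_circleAverage_zero_one] at h
  have hu : ‖(‖d‖ / d : ℂ)‖ = 1 := by simp [hR]
  have e : (fun ζ => Real.log ‖c + ζ * d‖) =
      fun z : ℂ => Real.log ‖(‖d‖ : ℂ) * z + c * (‖d‖ / d) - 0‖ := by
    ext z
    have : (‖d‖ : ℂ) * z + c * (‖d‖ / d) - 0 = (c + z * d) * (‖d‖ / d) := by field_simp; ring
    rw [this, norm_mul, hu, mul_one]
  rw [e, h, sub_zero, norm_mul, hu, mul_one,
    show ∀ x : ℝ, Real.posLog x = max 0 (Real.log x) from fun _ => rfl,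
    Real.log_mul (inv_ne_zero hR) (norm_ne_zero_iff.2 hc), Real.log_inv]
  rcases le_total (Real.log ‖d‖) (Real.log ‖c‖) with h' | h'
  · rw [max_eq_right h', max_eq_right (by linarith)]; ring
  · rw [max_eq_left h', max_eq_left (by linarith)]; ring

theorem log_norm_le_circleAverage {c : ℂ} (hc : c ≠ 0) (d : ℂ) :
    Real.log ‖c‖ ≤ Real.circleAverage (fun ζ => Real.log ‖c + ζ * d‖) 0 1 := by
  rcases circleAverage_log_norm_add_mul hc d with h | h
  · rw [h]; exact le_max_right _ _
  · simp [h, Real.circleAverage_const]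

theorem circleAverage_log_norm_of_norm_lt {c d : ℂ} (h : ‖d‖ < ‖c‖) :
    Real.circleAverage (fun ζ => Real.log ‖c + ζ * d‖) 0 1 = Real.log ‖c‖ := by
  have hc : c ≠ 0 := norm_pos_iff.1 ((norm_nonneg d).trans_lt h)
  rcases circleAverage_log_norm_add_mul hc d with h' | h'
  · by_cases hd : d = 0
    · simp [hd, Real.circleAverage_const]
    · rw [h', max_eq_right (Real.log_le_log (norm_pos_iff.2 hd) h.le)]
  · simp [h', Real.circleAverage_const]

theorem norm_lt_of_forall_add_mul_ne_zero {c d : ℂ} (h : ∀ ζ : ℂ, ‖ζ‖ ≤ 1 → c + ζ * d ≠ 0) :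
    ‖d‖ < ‖c‖ := by
  by_contra! hle
  by_cases hd : d = 0
  · subst hd
    have : c = 0 := by simpa using hle
    exact h 0 (by simp) (by simp [this])
  · refine h (-c / d) ?_ (by field_simp; ring)
    rw [norm_div, norm_neg]
    exact div_le_one_of_le₀ hle (norm_nonneg _)

theorem circleIntegrable_log_norm_add_mul (c d : ℂ) :
    CircleIntegrable (fun ζ => Real.log ‖c + ζ * d‖) 0 1 :=
  MeromorphicOn.circleIntegrable_log_norm (f := fun ζ => c + ζ * d) fun _ _ => by fun_prop

/-- If every point of a compact set at which the upper semicontinuous function `u` is at least `H`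
is the centre of a disk in the set on which `u` is submean and `H` strictly supermean,
then `u < H` on the set. -/
theorem lt_of_strictly_supermean {E : Type*} [NormedAddCommGroup E] [NormedSpace ℂ E]
    {u : E → EReal} {H : E → ℝ} {C : Set E} (hC : IsCompact C)
    (hu : UpperSemicontinuousOn u C) (hu_top : ∀ v ∈ C, u v < ⊤) (hH : ContinuousOn H C)
    (hdisk : ∀ v ∈ C, (H v : EReal) ≤ u v → ∃ b : E, (∀ ζ : ℂ, ‖ζ‖ ≤ 1 → v + ζ • b ∈ C) ∧
      u v ≤ circleMean (fun θ : ℝ => u (v + Complex.exp (θ * Complex.I) • b)) ∧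
      Real.circleAverage (fun ζ => H (v + ζ • b)) 0 1 < H v) :
    ∀ v ∈ C, u v < H v := by
  intro v₀ hv₀
  by_contra! hle
  have husc : UpperSemicontinuousOn (fun v => u v + ((-H v : ℝ) : EReal)) C := by
    refine hu.add' ?_ ?_
    · exact (continuous_coe_real_ereal.comp_continuousOn hH.neg).upperSemicontinuousOn
    · intro x _
      exact EReal.continuousAt_add (Or.inr (EReal.coe_ne_bot _)) (Or.inr (EReal.coe_ne_top _))
  obtain ⟨v, hv, hmax⟩ := husc.exists_isMaxOn ⟨v₀, hv₀⟩ hC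
  have h0 : (0 : EReal) ≤ u v + ((-H v : ℝ) : EReal) := by
    refine le_trans ?_ (hmax hv₀)
    calc (0 : EReal) = (H v₀ : EReal) + ((-H v₀ : ℝ) : EReal) := by
          rw [← EReal.coe_add, add_neg_cancel, EReal.coe_zero]
      _ ≤ _ := add_le_add_left hle _
  have hbot : u v ≠ ⊥ := by
    intro h
    rw [h, EReal.bot_add] at h0
    simp at h0
  obtain ⟨a, ha⟩ : ∃ a : ℝ, u v = a := ⟨(u v).toReal, (EReal.coe_toReal (hu_top v hv).ne hbot).symm⟩
  -- At a maximum point `v` of `u - H`, a translate of `H` touches `u` from above; averaging over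
  -- the disk at `v` then contradicts strict supermeanness.
  have hbound : ∀ w ∈ C, u w ≤ ((H w + (a - H v) : ℝ) : EReal) := by
    intro w hw
    have h := hmax hw
    simp only [mem_ofPred_eq, ha] at h
    rw [← EReal.coe_add] at h
    induction hx : u w with
    | bot => exact bot_le
    | top => exact absurd hx (hu_top w hw).ne
    | coe x =>
      rw [hx, ← EReal.coe_add] at h
      have := EReal.coe_le_coe_iff.1 h
      exact EReal.coe_le_coe_iff.2 (by linarith)
  have ha0 : H v ≤ a := by
    rw [ha, ← EReal.coe_add] at h0
    have : (0:ℝ) ≤ a + -H v := by exact_mod_cast h0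
    linarith
  obtain ⟨b, hbC, hsub, hsup⟩ := hdisk v hv (by rw [ha]; exact EReal.coe_le_coe_iff.2 ha0)
  have hint : CircleIntegrable (fun ζ => H (v + ζ • b)) 0 1 := by
    refine ContinuousOn.circleIntegrable zero_le_one ?_
    refine hH.comp (by fun_prop) fun ζ hζ => hbC ζ ?_
    simpa using (mem_sphere_zero_iff_norm.1 hζ).le
  have hm : u v ≤ circleMean fun θ : ℝ =>
      (((fun ζ => H (v + ζ • b) + (a - H v)) (Complex.exp (θ * Complex.I)) : ℝ) : EReal) :=
    hsub.trans (circleMean_mono_ae (Eventually.of_forall fun θ =>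
      hbound _ (hbC _ (by rw [Complex.norm_exp_ofReal_mul_I]))))
  have hint' : CircleIntegrable (fun ζ => H (v + ζ • b) + (a - H v)) 0 1 :=
    hint.add (circleIntegrable_const _ _ _)
  rw [circleMean_coe hint',
    Real.circleAverage_fun_add hint (circleIntegrable_const _ _ _), Real.circleAverage_const, ha,
    EReal.coe_le_coe_iff] at hm
  linarith

/-- Each `log |ℓ i|` is subharmonic on lines, while `log |ℓ₀|` is harmonic off its zeros, so `q` may
have any sign. Taking the extended logarithm of a product gives `⊥` at zeros of factors with
positive exponent and lets factors with exponent zero drop out. An empty `ι` gives constants. -/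
theorem isPlurisubharmonicOn_log_prod {E ι : Type*} [NormedAddCommGroup E] [NormedSpace ℂ E]
    [Fintype ι] (ℓ : ι → E →L[ℂ] ℂ) {α : ι → ℝ} (hα : ∀ i, 0 ≤ α i) (ℓ₀ : E →L[ℂ] ℂ) (p q : ℝ)
    {U : Set E} (hq : q = 0 ∨ ∀ x ∈ U, ℓ₀ x ≠ 0) :
    IsPlurisubharmonicOn (fun x => ENNReal.log (ENNReal.ofReal (∏ i, ‖ℓ i x‖ ^ α i)) +
      ((p + q * Real.log ‖ℓ₀ x‖ : ℝ) : EReal)) U := by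
  have hnonneg : ∀ x, 0 ≤ ∏ i, ‖ℓ i x‖ ^ α i := fun x =>
    Finset.prod_nonneg fun i _ => Real.rpow_nonneg (norm_nonneg _) _
  refine ⟨fun z _ => ?_, ?_, fun a b hab => ?_⟩
  · exact EReal.add_lt_top (by simp [-ENNReal.log_ofReal]) (EReal.coe_ne_top _)
  · apply ContinuousOn.upperSemicontinuousOn
    have h1 : Continuous fun x => ENNReal.log (ENNReal.ofReal (∏ i, ‖ℓ i x‖ ^ α i)) := by
      refine ENNReal.continuous_log.comp (ENNReal.continuous_ofReal.comp ?_)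
      exact continuous_finsetProd _ fun i _ => (ℓ i).continuous.norm.rpow_const fun x =>
        Or.inr (hα i)
    have h2 : ContinuousOn (fun x => p + q * Real.log ‖ℓ₀ x‖) U := by
      rcases hq with rfl | hq
      · simpa using continuousOn_const
      · exact continuousOn_const.add (continuousOn_const.mul
          (ℓ₀.continuous.norm.continuousOn.log fun x hx => norm_ne_zero_iff.2 (hq x hx)))
    intro x hx
    exact ContinuousAt.comp_continuousWithinAt (g := fun y : EReal × EReal => y.1 + y.2)
      (EReal.continuousAt_add (Or.inr (EReal.coe_ne_bot _)) (Or.inr (EReal.coe_ne_top _)))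
      (h1.continuousWithinAt.prodMk
        (continuous_coe_real_ereal.continuousAt.comp_continuousWithinAt (h2 x hx)))
  · rcases (hnonneg a).eq_or_lt with h0 | hpos
    · simp [← h0]
    have hne : ∀ i, α i ≠ 0 → ℓ i a ≠ 0 := by
      intro i hi h
      refine hpos.ne' (Finset.prod_eq_zero (Finset.mem_univ i) ?_)
      rw [h, norm_zero, Real.zero_rpow hi]
    have hlog : ∀ x, (∀ i, α i ≠ 0 → ℓ i x ≠ 0) →
        ENNReal.log (ENNReal.ofReal (∏ i, ‖ℓ i x‖ ^ α i)) =
          ((∑ i, α i * Real.log ‖ℓ i x‖ : ℝ) : EReal) := by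
      intro x hx
      have hfac : ∀ i, 0 < ‖ℓ i x‖ ^ α i := by
        intro i
        by_cases hi : α i = 0
        · simp [hi]
        · exact Real.rpow_pos_of_pos (norm_pos_iff.2 (hx i hi)) _
      rw [ENNReal.log_ofReal_of_pos (Finset.prod_pos fun i _ => hfac i),
        Real.log_prod fun i _ => (hfac i).ne']
      congr 1
      refine Finset.sum_congr rfl fun i _ => ?_
      by_cases hi : α i = 0
      · simp [hi]
      · exact Real.log_rpow (norm_pos_iff.2 (hx i hi)) _
    let g : ℂ → ℝ := fun ζ => ∑ i, α i * Real.log ‖ℓ i a + ζ * ℓ i b‖ +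
      (p + q * Real.log ‖ℓ₀ a + ζ * ℓ₀ b‖)
    have hi1 : ∀ i, CircleIntegrable (fun ζ => α i * Real.log ‖ℓ i a + ζ * ℓ i b‖) 0 1 := fun i =>
      (circleIntegrable_log_norm_add_mul _ _).const_mul _
    have hi2 : CircleIntegrable (fun ζ => ∑ i, α i * Real.log ‖ℓ i a + ζ * ℓ i b‖) 0 1 :=
      CircleIntegrable.fun_sum _ fun i _ => hi1 i
    have hi3 : CircleIntegrable (fun ζ => q * Real.log ‖ℓ₀ a + ζ * ℓ₀ b‖) 0 1 :=
      (circleIntegrable_log_norm_add_mul _ _).const_mul _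
    have hi4 : CircleIntegrable (fun ζ => p + q * Real.log ‖ℓ₀ a + ζ * ℓ₀ b‖) 0 1 :=
      (circleIntegrable_const p 0 1).add hi3
    have hg : CircleIntegrable g 0 1 := hi2.add hi4
    have hval : ∑ i, α i * Real.log ‖ℓ i a‖ + (p + q * Real.log ‖ℓ₀ a‖) ≤
        Real.circleAverage g 0 1 := by
      rw [Real.circleAverage_fun_add hi2 hi4, Real.circleAverage_fun_sum fun i _ => hi1 i,
        Real.circleAverage_fun_add (circleIntegrable_const _ _ _) hi3, Real.circleAverage_const,
        circleAverage_const_mul]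
      have h0 : q * Real.log ‖ℓ₀ a‖ =
          q * Real.circleAverage (fun ζ => Real.log ‖ℓ₀ a + ζ * ℓ₀ b‖) 0 1 := by
        rcases hq with rfl | hq
        · simp
        · rw [circleAverage_log_norm_of_norm_lt]
          refine norm_lt_of_forall_add_mul_ne_zero fun ζ hζ => ?_
          simpa using hq _ (hab ζ hζ)
      rw [h0]
      gcongr with i
      rw [circleAverage_const_mul]
      by_cases hi : α i = 0
      · simp [hi]
      · exact mul_le_mul_of_nonneg_left (log_norm_le_circleAverage (hne i hi) _) (hα i)
    calc _ = ((∑ i, α i * Real.log ‖ℓ i a‖ + (p + q * Real.log ‖ℓ₀ a‖) : ℝ) : EReal) := by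
          rw [hlog a hne, ← EReal.coe_add]
      _ ≤ ((Real.circleAverage g 0 1 : ℝ) : EReal) := EReal.coe_le_coe_iff.2 hval
      _ = circleMean fun θ : ℝ => (g (Complex.exp (θ * Complex.I)) : EReal) :=
          (circleMean_coe hg).symm
      _ ≤ _ := by
        apply circleMean_mono_ae
        -- The real sum of logarithms agrees with the extended logarithm only where no relevant
        -- factor vanishes, since `Real.log 0 = 0`; this fails for countably many angles only.
        have hnull : ∀ᵐ θ : ℝ ∂volume.restrict (Ioc 0 (2 * Real.pi)), ∀ i, α i ≠ 0 →
            ℓ i (a + Complex.exp (θ * Complex.I) • b) ≠ 0 := by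
          refine ae_restrict_of_ae (ae_all_iff.2 fun i => ?_)
          by_cases hi : α i = 0
          · simp [hi]
          have hc : (circleMap 0 1 ⁻¹' {-ℓ i a / ℓ i b}).Countable :=
            (countable_singleton _).preimage_circleMap 0 one_ne_zero
          filter_upwards [hc.ae_notMem volume] with θ hθ _ h
          apply hθ
          rw [map_add, map_smul, smul_eq_mul] at h
          have hb : ℓ i b ≠ 0 := by
            intro hb
            exact hne i hi (by simpa [hb] using h)
          simp only [mem_preimage, circleMap, zero_add, Complex.ofReal_one, one_mul,
            mem_singleton_iff]
          field_simp
          linear_combination h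
        filter_upwards [hnull] with θ hθ
        rw [hlog _ hθ, ← EReal.coe_add]
        simp [g]

/-! ### Complete logarithmically convex Reinhardt sets. -/

section Reinhardt

variable {n : ℕ} {K : Set (Fin n → ℂ)}

theorem log_norm_mem_logImage (hs : K ⊆ unitPolydisk n) (hR : IsReinhardt K) {z : Fin n → ℂ}
    (hz : z ∈ K) (h0 : ∀ l, z l ≠ 0) : (fun l => Real.log ‖z l‖) ∈ logImage K := by
  refine ⟨fun l => Real.log_neg (norm_pos_iff.2 (h0 l)) (hs hz l), hR z hz _ fun l => ?_⟩
  rw [Real.exp_log (norm_pos_iff.2 (h0 l)), Complex.norm_real, norm_norm]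

theorem mem_of_log_norm_mem_logImage (hR : IsReinhardt K) {z : Fin n → ℂ} (h0 : ∀ l, z l ≠ 0)
    (hz : (fun l => Real.log ‖z l‖) ∈ logImage K) : z ∈ K := by
  refine hR _ hz.2 _ fun l => ?_
  rw [Real.exp_log (norm_pos_iff.2 (h0 l)), Complex.norm_real, norm_norm]

theorem IsCompleteLogConvex.mem_of_norm_lt (hK : IsCompleteLogConvex K)
    (hs : K ⊆ unitPolydisk n) (hR : IsReinhardt K) {z w : Fin n → ℂ} (hz : z ∈ K)
    (h0 : ∀ l, w l ≠ 0) (h : ∀ l, ‖w l‖ < ‖z l‖) : w ∈ K := by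
  have hz0 : ∀ l, z l ≠ 0 := fun l => norm_pos_iff.1 ((norm_nonneg _).trans_lt (h l))
  refine mem_of_log_norm_mem_logImage hR h0 (hK.complete ?_)
  refine ⟨_, log_norm_mem_logImage hs hR hz hz0, fun l => Real.log ‖w l‖ - Real.log ‖z l‖,
    fun l => sub_neg.2 (Real.log_lt_log (norm_pos_iff.2 (h0 l)) (h l)), ?_⟩
  ext l
  simp

theorem mem_closure_norm_lt {r : ℝ} (hr : 0 < r) {c : ℂ} (hc : ‖c‖ ≤ r) :
    c ∈ closure {w : ℂ | w ≠ 0 ∧ ‖w‖ < r} := by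
  by_cases h : c = 0
  · subst h
    have hT : Tendsto (fun s : ℝ => ((s * r : ℝ) : ℂ)) (𝓝[>] 0) (𝓝 0) := by
      have : Continuous fun s : ℝ => ((s * r : ℝ) : ℂ) := by fun_prop
      simpa using (this.tendsto 0).mono_left nhdsWithin_le_nhds
    refine mem_closure_of_tendsto hT ?_
    filter_upwards [Ioo_mem_nhdsGT (zero_lt_one' ℝ)] with s hs
    have hp : 0 < s * r := mul_pos hs.1 hr
    refine ⟨by exact_mod_cast hp.ne', ?_⟩
    rw [Complex.norm_real, Real.norm_of_nonneg hp.le]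
    nlinarith [hs.2]
  · have hT : Tendsto (fun s : ℝ => ((1 - s : ℝ) : ℂ) * c) (𝓝[>] 0) (𝓝 c) := by
      have : Continuous fun s : ℝ => ((1 - s : ℝ) : ℂ) * c := by fun_prop
      simpa using (this.tendsto 0).mono_left nhdsWithin_le_nhds
    refine mem_closure_of_tendsto hT ?_
    filter_upwards [Ioo_mem_nhdsGT (zero_lt_one' ℝ)] with s hs
    have hp : 0 < 1 - s := by linarith [hs.2]
    refine ⟨mul_ne_zero (by exact_mod_cast hp.ne') h, ?_⟩
    rw [norm_mul, Complex.norm_real, Real.norm_of_nonneg hp.le]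
    nlinarith [hs.1, norm_pos_iff.2 h]

/-- Completeness of the logarithmic image handles only strictly smaller nonzero moduli; closedness
and the density of points without zero coordinates supply the rest. -/
theorem IsCompleteLogConvex.mem_of_norm_le (hK : IsCompleteLogConvex K) (hc : IsClosed K)
    (hs : K ⊆ unitPolydisk n) (hR : IsReinhardt K) {z w : Fin n → ℂ} (hz : z ∈ K)
    (h : ∀ l, ‖w l‖ ≤ ‖z l‖) : w ∈ K := by
  have key : ∀ z ∈ K, (∀ l, z l ≠ 0) → ∀ w : Fin n → ℂ, (∀ l, ‖w l‖ ≤ ‖z l‖) → w ∈ K := by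
    intro z hz h0 w h
    have hw : w ∈ closure (univ.pi fun l => {c : ℂ | c ≠ 0 ∧ ‖c‖ < ‖z l‖}) := by
      rw [closure_pi_set]
      exact fun l _ => mem_closure_norm_lt (norm_pos_iff.2 (h0 l)) (h l)
    refine closure_minimal ?_ hc hw
    exact fun v hv => hK.mem_of_norm_lt hs hR hz (fun l => (hv l trivial).1)
      fun l => (hv l trivial).2
  -- This map sends `z` to `w`: where `z l = 0`, also `w l = 0`, and the quotient is `0` by
  -- convention.
  have hcont : Continuous fun (v : Fin n → ℂ) l => w l / z l * v l := by fun_prop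
  have hm := map_mem_closure hcont (hK.dense hz) (t := K) fun v hv => by
    refine key v hv.1 hv.2 _ fun l => ?_
    rw [norm_mul, norm_div]
    exact mul_le_of_le_one_left (norm_nonneg _) (div_le_one_of_le₀ (h l) (norm_nonneg _))
  rw [hc.closure_eq] at hm
  convert hm using 1
  ext l
  by_cases hl : z l = 0
  · have := h l
    simp only [hl, norm_zero, norm_le_zero_iff] at this
    simp [hl, this]
  · field_simp

/-- Closed complete logarithmically convex sets contain the geometric means of their points. -/
theorem IsCompleteLogConvex.mem_of_norm_eq_mul (hK : IsCompleteLogConvex K) (hc : IsClosed K)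
    (hs : K ⊆ unitPolydisk n) (hR : IsReinhardt K) {z w v : Fin n → ℂ} (hz : z ∈ K) (hw : w ∈ K)
    {a b : ℝ} (ha : 0 < a) (hb : 0 < b) (hab : a + b = 1)
    (h : ∀ l, ‖v l‖ = ‖z l‖ ^ a * ‖w l‖ ^ b) : v ∈ K := by
  let F : (Fin n → ℂ) → (Fin n → ℂ) → Fin n → ℂ :=
    fun z w l => ((‖z l‖ ^ a * ‖w l‖ ^ b : ℝ) : ℂ)
  have hF : Continuous (Function.uncurry F) := by
    refine continuous_pi fun l => Complex.continuous_ofReal.comp (Continuous.mul ?_ ?_)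
    · exact Continuous.rpow_const (by fun_prop) fun _ => Or.inr ha.le
    · exact Continuous.rpow_const (by fun_prop) fun _ => Or.inr hb.le
  have hFn : ∀ z w l, ‖F z w l‖ = ‖z l‖ ^ a * ‖w l‖ ^ b := fun z w l => by
    rw [Complex.norm_real, Real.norm_of_nonneg (by positivity)]
  have hm : F z w ∈ closure K := map_mem_closure₂ hF (hK.dense hz) (hK.dense hw) ?_
  · rw [hc.closure_eq] at hm
    exact hR _ hm _ fun l => by rw [hFn, h]
  · intro z hz w hw
    have hpz := fun l => norm_pos_iff.2 (hz.2 l)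
    have hpw := fun l => norm_pos_iff.2 (hw.2 l)
    refine mem_of_log_norm_mem_logImage hR (fun l => ?_) ?_
    · rw [← norm_pos_iff, hFn]
      exact mul_pos (Real.rpow_pos_of_pos (hpz l) _) (Real.rpow_pos_of_pos (hpw l) _)
    · convert hK.convex (log_norm_mem_logImage hs hR hz.1 hz.2)
        (log_norm_mem_logImage hs hR hw.1 hw.2) ha.le hb.le hab using 1
      ext l
      rw [hFn, Real.log_mul (Real.rpow_pos_of_pos (hpz l) _).ne'
        (Real.rpow_pos_of_pos (hpw l) _).ne', Real.log_rpow (hpz l), Real.log_rpow (hpw l)]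
      simp

/-- Density replaces `z` by a nearby `v ∈ K` without zero coordinates and with moduli above `s
|z_l|`; the polydisk of `v` then contains `s y` for all `y` near `z`, even where `z` has zero
coordinates. -/
theorem IsCompleteLogConvex.eventually_smul_mem (hK : IsCompleteLogConvex K) (hc : IsClosed K)
    (hs : K ⊆ unitPolydisk n) (hR : IsReinhardt K) {z : Fin n → ℂ} (hz : z ∈ K) {s : ℝ}
    (hs0 : 0 < s) (hs1 : s < 1) : ∀ᶠ y in 𝓝 z, (s : ℂ) • y ∈ K := by
  have hopen : ∀ᶠ v in 𝓝 z, ∀ l, s * ‖z l‖ < ‖v l‖ ∨ z l = 0 := by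
    refine eventually_all.2 fun l => ?_
    by_cases hl : z l = 0
    · exact Eventually.of_forall fun _ => Or.inr hl
    · have hcont : Continuous fun v : Fin n → ℂ => ‖v l‖ := by fun_prop
      refine (hcont.continuousAt.eventually (lt_mem_nhds ?_)).mono fun _ => Or.inl
      nlinarith [norm_pos_iff.2 hl]
  obtain ⟨v, hv, hvK, hv0⟩ := mem_closure_iff_nhds.1 (hK.dense hz) _ hopen
  have hev : ∀ᶠ y in 𝓝 z, ∀ l, s * ‖y l‖ < ‖v l‖ := by
    refine eventually_all.2 fun l => ?_
    have hcont : Continuous fun y : Fin n → ℂ => s * ‖y l‖ := by fun_prop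
    refine hcont.continuousAt.eventually (gt_mem_nhds ?_)
    rcases hv l with h | h
    · exact h
    · simp [h, hv0 l]
  filter_upwards [hev] with y hy
  refine hK.mem_of_norm_le hc hs hR hvK fun l => ?_
  rw [Pi.smul_apply, norm_smul, Complex.norm_real, Real.norm_of_nonneg hs0.le]
  exact (hy l).le

theorem exists_norm_le_of_isCompact (hc : IsCompact K) (hs : K ⊆ unitPolydisk n) :
    ∃ ρ : ℝ, 0 < ρ ∧ ρ < 1 ∧ ∀ z ∈ K, ∀ l, ‖z l‖ ≤ ρ := by
  rcases K.eq_empty_or_nonempty with rfl | hne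
  · exact ⟨1 / 2, by norm_num, by norm_num, by simp⟩
  obtain ⟨v, hv, hmax⟩ := hc.exists_isMaxOn hne continuous_norm.continuousOn
  refine ⟨max ‖v‖ (1 / 2), by positivity, max_lt ?_ (by norm_num), fun z hz l => ?_⟩
  · exact (pi_norm_lt_iff one_pos).2 (hs hv)
  · exact (norm_le_pi_norm z l).trans ((hmax hz).trans (le_max_left _ _))

/-- The zero function would witness that the empty set is pluripolar. -/
theorem nonempty_of_not_isPluripolar (h : ¬ IsPluripolar K) : K.Nonempty := by
  by_contra hne
  rw [not_nonempty_iff_eq_empty] at hne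
  refine h ⟨fun _ => 0, ⟨by simp, upperSemicontinuousOn_const, fun a b _ => ?_⟩, ⟨0, by simp⟩,
    by simp [hne]⟩
  simp [circleMean]

end Reinhardt

/-! ### Closure properties of the geometric mean. -/

section GeometricMean

variable {n : ℕ} {K₀ K₁ : Set (Fin n → ℂ)} {t : ℝ}

theorem isClosed_geometricMean (h₀ : IsCompact K₀) (h₁ : IsCompact K₁) (ht0 : 0 < t)
    (ht1 : t < 1) : IsClosed (geometricMean K₀ K₁ t) := by
  let F : (Fin n → ℂ) × (Fin n → ℂ) → Fin n → ℝ := fun p l => ‖p.1 l‖ ^ (1 - t) * ‖p.2 l‖ ^ t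
  have hF : Continuous F := by
    refine continuous_pi fun l => Continuous.mul ?_ ?_
    · exact Continuous.rpow_const (by fun_prop) fun _ => Or.inr (by linarith)
    · exact Continuous.rpow_const (by fun_prop) fun _ => Or.inr ht0.le
  have hN : Continuous fun (z : Fin n → ℂ) l => ‖z l‖ := by fun_prop
  convert ((h₀.prod h₁).image hF).isClosed.preimage hN using 1
  ext z
  simp only [geometricMean, mem_ofPred_eq, mem_preimage, mem_image, mem_prod, Prod.exists]
  constructor
  · rintro ⟨η, hη, ξ, hξ, h⟩
    exact ⟨η, ξ, ⟨hη, hξ⟩, funext fun l => (h l).symm⟩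
  · rintro ⟨η, ξ, ⟨hη, hξ⟩, h⟩
    exact ⟨η, hη, ξ, hξ, fun l => (congrFun h l).symm⟩

theorem geometricMean_subset_unitPolydisk (h₀ : K₀ ⊆ unitPolydisk n) (h₁ : K₁ ⊆ unitPolydisk n)
    (ht0 : 0 < t) (ht1 : t < 1) : geometricMean K₀ K₁ t ⊆ unitPolydisk n := by
  rintro z ⟨η, hη, ξ, hξ, h⟩ l
  rw [h l]
  exact mul_lt_one_of_nonneg_of_lt_one_left (by positivity)
    (Real.rpow_lt_one (norm_nonneg _) (h₀ hη l) (by linarith))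
    (Real.rpow_lt_one (norm_nonneg _) (h₁ hξ l) ht0).le

/-- Scaling both `η` and `ξ` by the ratios `w l / z l` scales their mean by the same moduli, the
exponents having sum one. -/
theorem mem_geometricMean_of_norm_le (h₀ : IsCompleteLogConvex K₀) (hc₀ : IsClosed K₀)
    (hs₀ : K₀ ⊆ unitPolydisk n) (hR₀ : IsReinhardt K₀) (h₁ : IsCompleteLogConvex K₁)
    (hc₁ : IsClosed K₁) (hs₁ : K₁ ⊆ unitPolydisk n) (hR₁ : IsReinhardt K₁) {z w : Fin n → ℂ}
    (hz : z ∈ geometricMean K₀ K₁ t) (h : ∀ l, ‖w l‖ ≤ ‖z l‖) : w ∈ geometricMean K₀ K₁ t := by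
  obtain ⟨η, hη, ξ, hξ, he⟩ := hz
  have hle : ∀ l, ‖w l / z l‖ ≤ 1 := fun l => by
    rw [norm_div]
    exact div_le_one_of_le₀ (h l) (norm_nonneg _)
  refine ⟨fun l => w l / z l * η l, h₀.mem_of_norm_le hc₀ hs₀ hR₀ hη fun l => ?_,
    fun l => w l / z l * ξ l, h₁.mem_of_norm_le hc₁ hs₁ hR₁ hξ fun l => ?_, fun l => ?_⟩
  · rw [norm_mul]
    exact mul_le_of_le_one_left (norm_nonneg _) (hle l)
  · rw [norm_mul]
    exact mul_le_of_le_one_left (norm_nonneg _) (hle l)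
  · rw [norm_mul, norm_mul, Real.mul_rpow (norm_nonneg _) (norm_nonneg _),
      Real.mul_rpow (norm_nonneg _) (norm_nonneg _), mul_mul_mul_comm, ← he l]
    have : ‖w l / z l‖ ^ (1 - t) * ‖w l / z l‖ ^ t = ‖w l / z l‖ := by
      rw [← Real.rpow_add' (norm_nonneg _) (by norm_num)]
      norm_num
    rw [this, ← norm_mul]
    by_cases hl : z l = 0
    · have := h l
      simp only [hl, norm_zero, norm_le_zero_iff] at this
      simp [hl, this]
    · field_simp

theorem mem_geometricMean_of_norm_eq_mul (h₀ : IsCompleteLogConvex K₀) (hc₀ : IsClosed K₀)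
    (hs₀ : K₀ ⊆ unitPolydisk n) (hR₀ : IsReinhardt K₀) (h₁ : IsCompleteLogConvex K₁)
    (hc₁ : IsClosed K₁) (hs₁ : K₁ ⊆ unitPolydisk n) (hR₁ : IsReinhardt K₁) {z w v : Fin n → ℂ}
    (hz : z ∈ geometricMean K₀ K₁ t) (hw : w ∈ geometricMean K₀ K₁ t)
    {a b : ℝ} (ha : 0 < a) (hb : 0 < b) (hab : a + b = 1)
    (h : ∀ l, ‖v l‖ = ‖z l‖ ^ a * ‖w l‖ ^ b) : v ∈ geometricMean K₀ K₁ t := by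
  obtain ⟨η, hη, ξ, hξ, he⟩ := hz
  obtain ⟨η', hη', ξ', hξ', he'⟩ := hw
  have hF : ∀ (z w : Fin n → ℂ) (l : Fin n), ‖((‖z l‖ ^ a * ‖w l‖ ^ b : ℝ) : ℂ)‖ =
      ‖z l‖ ^ a * ‖w l‖ ^ b := fun z w l => by
    rw [Complex.norm_real, Real.norm_of_nonneg (by positivity)]
  refine ⟨fun l => ((‖η l‖ ^ a * ‖η' l‖ ^ b : ℝ) : ℂ),
    h₀.mem_of_norm_eq_mul hc₀ hs₀ hR₀ hη hη' ha hb hab fun l => hF η η' l,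
    fun l => ((‖ξ l‖ ^ a * ‖ξ' l‖ ^ b : ℝ) : ℂ),
    h₁.mem_of_norm_eq_mul hc₁ hs₁ hR₁ hξ hξ' ha hb hab fun l => hF ξ ξ' l, fun l => ?_⟩
  rw [hF, hF, h l, he l, he' l, Real.mul_rpow (by positivity) (by positivity),
    Real.mul_rpow (by positivity) (by positivity), Real.mul_rpow (by positivity) (by positivity),
    Real.mul_rpow (by positivity) (by positivity)]
  simp only [← Real.rpow_mul (norm_nonneg _)]
  rw [mul_comm (1 - t) a, mul_comm (1 - t) b, mul_comm t a, mul_comm t b]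
  ring

end GeometricMean

/-! ### The maximum principle on annuli. -/

theorem EReal.le_coe_of_forall_pos {x : EReal} {a k : ℝ}
    (h : ∀ δ > 0, x ≤ ((a + δ * k : ℝ) : EReal)) : x ≤ a := by
  have hT : Tendsto (fun δ : ℝ => ((a + δ * k : ℝ) : EReal)) (𝓝[>] 0) (𝓝 (a : EReal)) := by
    have hc : Continuous fun δ : ℝ => ((a + δ * k : ℝ) : EReal) :=
      continuous_coe_real_ereal.comp (by fun_prop)
    simpa using (hc.tendsto 0).mono_left nhdsWithin_le_nhds
  exact ge_of_tendsto hT (eventually_nhdsWithin_of_forall fun δ hδ => h δ hδ)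

theorem circleAverage_re_mul (k : ℂ) :
    Real.circleAverage (fun ζ : ℂ => (ζ * k).re) 0 1 = 0 := by
  have hd : Differentiable ℂ fun ζ : ℂ => ζ * k := by fun_prop
  have h1 := (hd.diffContOnCl (s := Metric.ball 0 |1|)).circleAverage
  have h2 := Complex.reCLM.circleAverage_comp_comm (f := fun ζ : ℂ => ζ * k) (c := 0) (R := 1)
    (hd.continuous.continuousOn.circleIntegrable zero_le_one)
  rw [h1] at h2
  simpa [Function.comp_def] using h2

theorem circleAverage_norm_add_mul_sq (c d : ℂ) :
    Real.circleAverage (fun ζ : ℂ => ‖c + ζ * d‖ ^ 2) 0 1 = ‖c‖ ^ 2 + ‖d‖ ^ 2 := by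
  have h : EqOn (fun ζ : ℂ => ‖c + ζ * d‖ ^ 2)
      (fun ζ => (‖c‖ ^ 2 + ‖d‖ ^ 2) + 2 * (ζ * (d * starRingEnd ℂ c)).re)
      (Metric.sphere 0 |1|) := by
    intro ζ hζ
    have h1 : ‖ζ‖ = 1 := by simpa using hζ
    have h2 : ‖ζ * d‖ ^ 2 = ‖d‖ ^ 2 := by rw [norm_mul, h1, one_mul]
    have h3 := Complex.normSq_add c (ζ * d)
    simp only [Complex.normSq_eq_norm_sq] at h3
    simp only [h3, h2]
    congr 2
    rw [← Complex.conj_re]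
    congr 1
    simp only [map_mul, Complex.conj_conj]
    ring
  have hi : CircleIntegrable (fun ζ : ℂ => 2 * (ζ * (d * starRingEnd ℂ c)).re) 0 1 :=
    Continuous.continuousOn (by fun_prop) |>.circleIntegrable zero_le_one
  rw [Real.circleAverage_congr_sphere h, Real.circleAverage_fun_add (circleIntegrable_const _ _ _)
    hi, Real.circleAverage_const, circleAverage_const_mul, circleAverage_re_mul]
  ring

/-- The maximum principle on a closed annulus, with radial logarithmic comparison functions. -/
theorem le_add_mul_log_norm_of_annulus {v : ℂ → EReal} {r R α β : ℝ} (hr : 0 < r)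
    (husc : UpperSemicontinuousOn v {ζ | r ≤ ‖ζ‖ ∧ ‖ζ‖ ≤ R})
    (htop : ∀ ζ, r ≤ ‖ζ‖ → ‖ζ‖ ≤ R → v ζ < ⊤)
    (hsub : ∀ a b : ℂ, (∀ ζ : ℂ, ‖ζ‖ ≤ 1 → r ≤ ‖a + ζ * b‖ ∧ ‖a + ζ * b‖ ≤ R) →
      v a ≤ circleMean fun θ : ℝ => v (a + Complex.exp (θ * Complex.I) * b))
    (hvr : ∀ ζ, ‖ζ‖ = r → v ζ ≤ ((α + β * Real.log r : ℝ) : EReal))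
    (hvR : ∀ ζ, ‖ζ‖ = R → v ζ ≤ ((α + β * Real.log R : ℝ) : EReal)) {ζ : ℂ}
    (hζr : r ≤ ‖ζ‖) (hζR : ‖ζ‖ ≤ R) : v ζ ≤ ((α + β * Real.log ‖ζ‖ : ℝ) : EReal) := by
  have hC : IsCompact {ζ : ℂ | r ≤ ‖ζ‖ ∧ ‖ζ‖ ≤ R} := by
    refine (isCompact_closedBall (0 : ℂ) R).of_isClosed_subset ?_ fun ζ hζ => by simpa using hζ.2
    exact (isClosed_le continuous_const continuous_norm).inter
      (isClosed_le continuous_norm continuous_const)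
  apply EReal.le_coe_of_forall_pos (k := R ^ 2 + 1 - ‖ζ‖ ^ 2)
  intro δ hδ
  -- The last term makes the harmonic function strictly supermean, and its positivity on the annulus
  -- rules out `v ≥ H` on the boundary circles.
  let H : ℂ → ℝ := fun ζ => α + β * Real.log ‖ζ‖ + δ * (R ^ 2 + 1 - ‖ζ‖ ^ 2)
  refine (lt_of_strictly_supermean (H := H) hC husc (fun ζ hζ => htop ζ hζ.1 hζ.2) ?_ ?_ ζ
    ⟨hζr, hζR⟩).le
  · have h0 : ∀ ζ ∈ {ζ : ℂ | r ≤ ‖ζ‖ ∧ ‖ζ‖ ≤ R}, ‖ζ‖ ≠ 0 := fun ζ hζ => (hr.trans_le hζ.1).ne'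
    exact (continuousOn_const.add (continuousOn_const.mul
      (continuous_norm.continuousOn.log h0))).add (by fun_prop)
  · rintro a ⟨har, haR⟩ hle
    have hpos : 0 < R ^ 2 + 1 - ‖a‖ ^ 2 := by nlinarith [norm_nonneg a]
    have hlt : ((α + β * Real.log ‖a‖ : ℝ) : EReal) < H a := by
      refine EReal.coe_lt_coe_iff.2 ?_
      have := mul_pos hδ hpos
      simp only [H]
      linarith
    have har' : r < ‖a‖ := lt_of_le_of_ne har fun h => by
      have := hvr a h.symm
      rw [h] at this
      exact absurd (hlt.trans_le hle) this.not_gt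
    have haR' : ‖a‖ < R := lt_of_le_of_ne haR fun h => by
      have := hvR a h
      rw [← h] at this
      exact absurd (hlt.trans_le hle) this.not_gt
    have ha : 0 < ‖a‖ := hr.trans har'
    obtain ⟨ε, hε, hε1⟩ : ∃ ε > 0, ε < min (‖a‖ - r) (R - ‖a‖) :=
      exists_between (lt_min (by linarith) (by linarith))
    have hεr := hε1.trans_le (min_le_left _ _)
    have hεR := hε1.trans_le (min_le_right _ _)
    have hεn : ‖(ε : ℂ)‖ = ε := by rw [Complex.norm_real, Real.norm_of_nonneg hε.le]
    have hdisk : ∀ ζ : ℂ, ‖ζ‖ ≤ 1 → r ≤ ‖a + ζ * (ε : ℂ)‖ ∧ ‖a + ζ * (ε : ℂ)‖ ≤ R := by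
      intro ζ hζ
      have h1 : ‖ζ * (ε : ℂ)‖ ≤ ε := by
        rw [norm_mul, hεn]
        nlinarith
      have h2 := norm_sub_le_norm_add a (ζ * (ε : ℂ))
      have h3 := norm_add_le a (ζ * (ε : ℂ))
      constructor <;> linarith
    refine ⟨ε, hdisk, hsub a ε hdisk, ?_⟩
    have hi1 : CircleIntegrable (fun ζ => β * Real.log ‖a + ζ * (ε : ℂ)‖) 0 1 :=
      (circleIntegrable_log_norm_add_mul _ _).const_mul _
    have hi2 : CircleIntegrable (fun ζ => α + β * Real.log ‖a + ζ * (ε : ℂ)‖) 0 1 :=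
      (circleIntegrable_const α 0 1).add hi1
    have hi3 : CircleIntegrable (fun ζ => ‖a + ζ * (ε : ℂ)‖ ^ 2) 0 1 :=
      Continuous.continuousOn (by fun_prop) |>.circleIntegrable zero_le_one
    have hi4 : CircleIntegrable (fun ζ => R ^ 2 + 1 - ‖a + ζ * (ε : ℂ)‖ ^ 2) 0 1 :=
      (circleIntegrable_const (R ^ 2 + 1) 0 1).sub hi3
    have hi5 : CircleIntegrable (fun ζ => δ * (R ^ 2 + 1 - ‖a + ζ * (ε : ℂ)‖ ^ 2)) 0 1 :=
      hi4.const_mul δ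
    simp only [H, smul_eq_mul]
    rw [Real.circleAverage_fun_add hi2 hi5, Real.circleAverage_fun_add
      (circleIntegrable_const _ _ _) hi1, circleAverage_const_mul, circleAverage_const_mul,
      Real.circleAverage_fun_sub (circleIntegrable_const _ _ _) hi3, Real.circleAverage_const,
      Real.circleAverage_const, circleAverage_norm_add_mul_sq,
      circleAverage_log_norm_of_norm_lt (by rw [hεn]; linarith), hεn]
    nlinarith [mul_pos hδ (pow_pos hε 2)]

/-! ### Estimates of the relative extremal function. -/

section Extremal

variable {n : ℕ} {K : Set (Fin n → ℂ)}

theorem isOpen_unitPolydisk (n : ℕ) : IsOpen (unitPolydisk n) := by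
  have : unitPolydisk n = ⋂ l, {z | ‖z l‖ < 1} := by
    ext z
    simp [unitPolydisk]
  rw [this]
  exact isOpen_iInter_of_finite fun l => isOpen_lt (by fun_prop) continuous_const

/-- Restrict `u` to the complex line through `0` and `y`. The circle `|ζ| = s` lies over `K` because
`K` is Reinhardt, the circle `|ζ| = R` over the polydisk; the bound is the radial harmonic function
with boundary values `-1` and `0`, taken at `ζ = 1`. -/
theorem le_neg_log_div_of_mem_extremalClass (hR : IsReinhardt K) {u : (Fin n → ℂ) → EReal}
    (hu : u ∈ extremalClass (unitPolydisk n) K) {y : Fin n → ℂ} {s R : ℝ} (hs0 : 0 < s)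
    (hs1 : s < 1) (hR1 : 1 < R) (hsy : (s : ℂ) • y ∈ K) (hRy : (R : ℂ) • y ∈ unitPolydisk n) :
    u y ≤ ((-(Real.log R / (Real.log R - Real.log s)) : ℝ) : EReal) := by
  obtain ⟨hpsh, hneg, hK⟩ := hu
  have hmem : ∀ ζ : ℂ, ‖ζ‖ ≤ R → ζ • y ∈ unitPolydisk n := by
    intro ζ hζ l
    have h := hRy l
    rw [Pi.smul_apply, norm_smul, Complex.norm_real, Real.norm_of_nonneg (by linarith)] at h
    rw [Pi.smul_apply, norm_smul]
    exact (mul_le_mul_of_nonneg_right hζ (norm_nonneg _)).trans_lt h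
  have hlR : 0 < Real.log R := Real.log_pos hR1
  have hls : Real.log s < 0 := Real.log_neg hs0 hs1
  have hne : Real.log R - Real.log s ≠ 0 := by linarith
  have h := le_add_mul_log_norm_of_annulus (v := fun ζ => u (ζ • y)) (r := s) (R := R)
    (α := -(Real.log R / (Real.log R - Real.log s))) (β := 1 / (Real.log R - Real.log s)) hs0
    ?_ ?_ ?_ ?_ ?_ (ζ := 1) (by simpa using hs1.le) (by simpa using hR1.le)
  · simpa using h
  · exact hpsh.usc.comp (by fun_prop) fun ζ hζ => hmem ζ hζ.2
  · exact fun ζ _ hζ => hpsh.lt_top _ (hmem ζ hζ)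
  · intro a b hab
    have := hpsh.submean (a • y) (b • y) fun ζ hζ => by
      rw [smul_smul, ← add_smul]
      exact hmem _ (hab ζ hζ).2
    simpa only [smul_smul, ← add_smul] using this
  · intro ζ hζ
    have hval : -(Real.log R / (Real.log R - Real.log s)) +
        1 / (Real.log R - Real.log s) * Real.log s = -1 := by field_simp; ring
    rw [hval]
    refine (hK _ (hR _ hsy _ fun l => ?_)).trans_eq (by simp)
    simp [hζ, abs_of_pos hs0]
  · intro ζ hζ
    have hval : -(Real.log R / (Real.log R - Real.log s)) +
        1 / (Real.log R - Real.log s) * Real.log R = 0 := by field_simp; ring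
    rw [hval]
    exact (hneg _ (hmem ζ hζ.le)).trans_eq (by simp)

/-- The upper regularization requires the envelope bound near `y`. From `s y ∈ K` one gets `s² x ∈
K` for all `x` near `y`, whence the factor `2` before `log s`. -/
theorem relExtremal_le_neg_log_div (hK : IsCompleteLogConvex K) (hc : IsClosed K)
    (hs : K ⊆ unitPolydisk n) (hR : IsReinhardt K) {y : Fin n → ℂ} {s R : ℝ} (hs0 : 0 < s)
    (hs1 : s < 1) (hR1 : 1 < R) (hsy : (s : ℂ) • y ∈ K) (hRy : (R : ℂ) • y ∈ unitPolydisk n) :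
    relExtremal (unitPolydisk n) K y ≤
      ((-(Real.log R / (Real.log R - 2 * Real.log s)) : ℝ) : EReal) := by
  have h1 : ∀ᶠ x in 𝓝 y, (s : ℂ) • (s : ℂ) • x ∈ K := by
    have hcont : Continuous fun x : Fin n → ℂ => (s : ℂ) • x := by fun_prop
    exact hcont.continuousAt.eventually (hK.eventually_smul_mem hc hs hR hsy hs0 hs1)
  have h2 : ∀ᶠ x in 𝓝 y, (R : ℂ) • x ∈ unitPolydisk n := by
    have hcont : Continuous fun x : Fin n → ℂ => (R : ℂ) • x := by fun_prop
    exact hcont.continuousAt.eventually ((isOpen_unitPolydisk n).mem_nhds hRy)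
  refine limsup_le_of_le (by isBoundedDefault) (eventually_nhdsWithin_of_eventually_nhds ?_)
  filter_upwards [h1, h2] with x hx1 hx2
  refine iSup₂_le fun u hu => ?_
  have hlog : 2 * Real.log s = Real.log (s * s) := by
    rw [Real.log_mul hs0.ne' hs0.ne']; ring
  rw [hlog]
  refine le_neg_log_div_of_mem_extremalClass hR hu (mul_pos hs0 hs0) (by nlinarith) hR1 ?_ hx2
  rwa [Complex.ofReal_mul, mul_smul]

/-- The relative extremal function is close to `-1` near the compact set. -/
theorem exists_relExtremal_le (hK : IsCompleteLogConvex K) (hc : IsCompact K)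
    (hs : K ⊆ unitPolydisk n) (hR : IsReinhardt K) {ε : ℝ} (hε : 0 < ε) :
    ∃ σ > 0, ∀ z ∈ K, ∀ y : Fin n → ℂ, (∀ l, ‖y l‖ ≤ Real.exp σ * ‖z l‖) →
      y ∈ unitPolydisk n ∧ relExtremal (unitPolydisk n) K y ≤ ((-1 + ε : ℝ) : EReal) := by
  obtain ⟨ρ, hρ0, hρ1, hρ⟩ := exists_norm_le_of_isCompact hc hs
  -- The logarithmic distance of `K` to the boundary is cut in three: one `κ` for the radius `R =
  -- e^κ`, one bounding `σ`, one to keep the inequality strict.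
  obtain ⟨κ, hκ⟩ : ∃ κ, Real.log ρ = -(3 * κ) := ⟨-Real.log ρ / 3, by ring⟩
  have hκ0 : 0 < κ := by linarith [Real.log_neg hρ0 hρ1]
  have hρκ : ρ = Real.exp (-(3 * κ)) := by rw [← hκ, Real.exp_log hρ0]
  -- The bound `2σ ≤ εκ` yields `κ / (κ + 2σ) ≥ 1 - ε`.
  refine ⟨min κ (ε * κ / 2), by positivity, fun z hz y hy => ?_⟩
  set σ := min κ (ε * κ / 2) with hσ
  have hσ0 : 0 < σ := by positivity
  have hσ1 : σ ≤ κ := min_le_left _ _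
  have hσ2 : σ ≤ ε * κ / 2 := min_le_right _ _
  have hbound : ∀ l, Real.exp κ * ‖y l‖ < 1 := by
    intro l
    calc Real.exp κ * ‖y l‖ ≤ Real.exp κ * (Real.exp σ * Real.exp (-(3 * κ))) := by
          gcongr
          exact (hy l).trans (by rw [← hρκ]; gcongr; exact hρ z hz l)
      _ = Real.exp (κ + σ + -(3 * κ)) := by rw [Real.exp_add, Real.exp_add]; ring
      _ < 1 := Real.exp_lt_one_iff.2 (by linarith)
  refine ⟨fun l => ?_, ?_⟩
  · have h1 : 1 ≤ Real.exp κ := Real.one_le_exp hκ0.le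
    nlinarith [hbound l, norm_nonneg (y l)]
  · refine (relExtremal_le_neg_log_div hK hc.isClosed hs hR (s := Real.exp (-σ))
      (R := Real.exp κ) (Real.exp_pos _) (Real.exp_lt_one_iff.2 (by linarith))
      (Real.one_lt_exp_iff.2 hκ0) ?_ fun l => ?_).trans ?_
    · refine hK.mem_of_norm_le hc.isClosed hs hR hz fun l => ?_
      rw [Pi.smul_apply, norm_smul, Complex.norm_real, Real.norm_of_nonneg (Real.exp_pos _).le,
        Real.exp_neg, inv_mul_le_iff₀ (Real.exp_pos _)]
      exact hy l
    · rw [Pi.smul_apply, norm_smul, Complex.norm_real, Real.norm_of_nonneg (Real.exp_pos _).le]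
      exact hbound l
    · rw [Real.log_exp, Real.log_exp]
      refine EReal.coe_le_coe_iff.2 ?_
      have hd : 0 < κ - 2 * -σ := by linarith
      rw [neg_le, neg_add, neg_neg, ← sub_eq_add_neg, le_div_iff₀ hd]
      nlinarith

/-- The filter `𝓝[Ω] z` does not exclude `z`, so the regularization dominates the envelope. -/
theorem le_relExtremal {Ω : Set (Fin n → ℂ)} {u : (Fin n → ℂ) → EReal}
    (hu : u ∈ extremalClass Ω K) {z : Fin n → ℂ} (hz : z ∈ Ω) : u z ≤ relExtremal Ω K z := by
  rw [relExtremal, limsup_eq]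
  refine le_sInf fun a ha => ?_
  exact (le_iSup₂ (f := fun u (_ : u ∈ extremalClass Ω K) => u z) u hu).trans
    (ha.self_of_nhdsWithin hz)

theorem relExtremal_le_zero {Ω : Set (Fin n → ℂ)} {z : Fin n → ℂ} :
    relExtremal Ω K z ≤ 0 := by
  refine limsup_le_of_le (by isBoundedDefault) (eventually_nhdsWithin_of_forall fun x hx => ?_)
  exact iSup₂_le fun u hu => hu.2.1 x hx

theorem neg_one_le_relExtremal {z : Fin n → ℂ} (hz : z ∈ unitPolydisk n) :
    -1 ≤ relExtremal (unitPolydisk n) K z := by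
  refine le_relExtremal (u := fun _ => -1) ⟨?_, ?_, ?_⟩ hz
  · have := isPlurisubharmonicOn_log_prod (ι := Empty) (E := Fin n → ℂ) (fun i => i.elim)
      (α := fun i => i.elim) (fun i => i.elim) 0 (-1) 0 (U := unitPolydisk n) (Or.inl rfl)
    simpa using this
  · intro _ _
    simp
  · simp

theorem exists_coe_eq_relExtremal {z : Fin n → ℂ} (hz : z ∈ unitPolydisk n) :
    ∃ a : ℝ, relExtremal (unitPolydisk n) K z = a ∧ -1 ≤ a ∧ a ≤ 0 := by
  have h1 := neg_one_le_relExtremal (K := K) hz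
  have h2 := relExtremal_le_zero (K := K) (Ω := unitPolydisk n) (z := z)
  induction h : relExtremal (unitPolydisk n) K z with
  | bot => exact absurd (h ▸ h1) (not_le.2 (EReal.bot_lt_coe (-1)))
  | top => simp [h] at h2
  | coe a =>
    rw [h] at h1 h2
    exact ⟨a, rfl, EReal.coe_le_coe_iff.1 h1, EReal.coe_le_coe_iff.1 h2⟩

end Extremal

/-! ### Boundary behaviour of the geodesic class. -/

section GeodesicClass

theorem boundaryCircle_eq_sphere (j : ℝ) :
    boundaryCircle j = Metric.sphere (0 : ℂ) (Real.exp j) := by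
  ext ζ
  simp only [boundaryCircle, mem_ofPred_eq, mem_sphere_zero_iff_norm]
  constructor
  · rintro ⟨h0, h⟩
    rw [← h, Real.exp_log (norm_pos_iff.2 h0)]
  · intro h
    refine ⟨norm_pos_iff.1 (h ▸ Real.exp_pos j), by rw [h, Real.log_exp]⟩

theorem eventually_of_nhdsSet_boundaryCircle {j : ℝ} {P : ℂ → Prop}
    (h : ∀ᶠ ζ in 𝓝ˢ (boundaryCircle j), P ζ) :
    ∀ᶠ x in 𝓝 j, ∀ ζ : ℂ, ‖ζ‖ = Real.exp x → P ζ := by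
  rw [boundaryCircle_eq_sphere] at h
  obtain ⟨δ, hδ, hsub⟩ := (Metric.hasBasis_nhdsSet_thickening
    (isCompact_sphere (0 : ℂ) (Real.exp j))).mem_iff.1 h
  have hT : Tendsto (fun x => |Real.exp x - Real.exp j|) (𝓝 j) (𝓝 0) := by
    have : Continuous fun x => |Real.exp x - Real.exp j| := by fun_prop
    simpa using this.tendsto j
  filter_upwards [hT.eventually (gt_mem_nhds hδ)] with x hx ζ hζ
  refine hsub (Metric.mem_thickening_iff.2 ⟨(Real.exp (j - x) : ℂ) * ζ, ?_, ?_⟩)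
  · rw [mem_sphere_zero_iff_norm, norm_mul, hζ, Complex.norm_real,
      Real.norm_of_nonneg (Real.exp_pos _).le, ← Real.exp_add]
    congr 1
    ring
  · rw [dist_eq_norm]
    have : ζ - (Real.exp (j - x) : ℂ) * ζ = ((1 - Real.exp (j - x) : ℝ) : ℂ) * ζ := by
      push_cast; ring
    rw [this, norm_mul, hζ, Complex.norm_real, Real.norm_eq_abs,
      ← abs_of_pos (Real.exp_pos x), ← abs_mul]
    rwa [sub_mul, one_mul, ← Real.exp_add, sub_add_cancel]

theorem exp_mem_annulus {x : ℝ} (h0 : 0 < x) (h1 : x < 1) {ζ : ℂ} (hζ : ‖ζ‖ = Real.exp x) :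
    ζ ∈ annulus :=
  ⟨norm_pos_iff.1 (hζ ▸ Real.exp_pos x), by rwa [hζ, Real.log_exp], by rwa [hζ, Real.log_exp]⟩

variable {n : ℕ} {Ω : Set (Fin n → ℂ)} {u₀ u₁ : (Fin n → ℂ) → EReal}

/-- Members of the geodesic class lie below the linear interpolation of the boundary values. -/
theorem le_interpolation_of_mem_geodesicClass {u : (Fin n → ℂ) × ℂ → EReal}
    (hu : u ∈ geodesicClass Ω u₀ u₁) {z : Fin n → ℂ} (hz : z ∈ Ω) {a b : ℝ}
    (ha : u₀ z = a) (hb : u₁ z = b) {ζ : ℂ} (hζ : ζ ∈ annulus) :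
    u (z, ζ) ≤ ((a + (b - a) * Real.log ‖ζ‖ : ℝ) : EReal) := by
  obtain ⟨hpsh, h0, h1⟩ := hu
  -- One `ε` pays for the limsup at the boundary circle, the other for the change of the affine
  -- function between `j` and a nearby radius.
  apply EReal.le_coe_of_forall_pos (k := 2)
  intro ε hε
  have hbd : ∀ (j c : ℝ), limsup (fun ζ => u (z, ζ)) (𝓝ˢ (boundaryCircle j) ⊓ 𝓟 annulus) ≤ c →
      ∀ᶠ x in 𝓝 j, ∀ ζ : ℂ, ‖ζ‖ = Real.exp x → ζ ∈ annulus →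
        u (z, ζ) ≤ ((c + ε : ℝ) : EReal) := by
    intro j c h
    have hlt : limsup (fun ζ => u (z, ζ)) (𝓝ˢ (boundaryCircle j) ⊓ 𝓟 annulus) <
        ((c + ε : ℝ) : EReal) := h.trans_lt (EReal.coe_lt_coe_iff.2 (by linarith))
    have := eventually_lt_of_limsup_lt hlt
    rw [eventually_inf_principal] at this
    exact (eventually_of_nhdsSet_boundaryCircle this).mono fun x hx ζ h1 h2 => (hx ζ h1 h2).le
  have hx0 : 0 < Real.log ‖ζ‖ := hζ.2.1
  have hx1 : Real.log ‖ζ‖ < 1 := hζ.2.2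
  have hlin : ∀ j : ℝ, ∀ᶠ x in 𝓝 j, -ε < (b - a) * (x - j) := by
    intro j
    have hc : Continuous fun x => (b - a) * (x - j) := by fun_prop
    exact hc.continuousAt.eventually (lt_mem_nhds (by simpa using hε))
  obtain ⟨x₀, ⟨hx₀, hx₀'⟩, hm₀⟩ := ((eventually_nhdsWithin_of_eventually_nhds
    ((hbd 0 a (by rw [← ha]; exact h0 z hz)).and (hlin 0))).and
      (Ioo_mem_nhdsGT hx0)).exists
  obtain ⟨x₁, ⟨hx₁, hx₁'⟩, hm₁⟩ := ((eventually_nhdsWithin_of_eventually_nhds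
    ((hbd 1 b (by rw [← hb]; exact h1 z hz)).and (hlin 1))).and
      (Ioo_mem_nhdsLT hx1)).exists
  have hζe : ‖ζ‖ = Real.exp (Real.log ‖ζ‖) := (Real.exp_log (norm_pos_iff.2 hζ.1)).symm
  have hann : ∀ w : ℂ, Real.exp x₀ ≤ ‖w‖ → ‖w‖ ≤ Real.exp x₁ → w ∈ annulus := by
    intro w h1 h2
    have hp := (Real.exp_pos _).trans_le h1
    refine ⟨norm_pos_iff.1 hp, ?_, ?_⟩
    · exact hm₀.1.trans_le ((Real.le_log_iff_exp_le hp).2 h1)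
    · exact ((Real.log_le_iff_le_exp hp).2 h2).trans_lt hm₁.2
  have hmain := le_add_mul_log_norm_of_annulus (v := fun ζ => u (z, ζ)) (r := Real.exp x₀)
    (R := Real.exp x₁) (α := a + 2 * ε) (β := b - a) (Real.exp_pos _) ?_ ?_ ?_ ?_ ?_ (ζ := ζ)
    (by rw [hζe]; exact Real.exp_le_exp.2 hm₀.2.le) (by rw [hζe]; exact Real.exp_le_exp.2 hm₁.1.le)
  · refine hmain.trans_eq ?_
    congr 1
    ring
  · exact hpsh.usc.comp (by fun_prop) fun w hw => ⟨hz, hann w hw.1 hw.2⟩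
  · exact fun w h1 h2 => hpsh.lt_top _ ⟨hz, hann w h1 h2⟩
  · intro c d hcd
    have := hpsh.submean (z, c) (0, d) fun w hw => by
      simpa using ⟨hz, hann _ (hcd w hw).1 (hcd w hw).2⟩
    simpa using this
  · intro w hw
    refine (hx₀ w hw (exp_mem_annulus hm₀.1 (by linarith [hm₀.2]) hw)).trans
      (EReal.coe_le_coe_iff.2 ?_)
    rw [Real.log_exp]
    linarith
  · intro w hw
    refine (hx₁ w hw (exp_mem_annulus (by linarith [hm₁.1]) hm₁.2 hw)).trans
      (EReal.coe_le_coe_iff.2 ?_)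
    rw [Real.log_exp]
    linarith

end GeodesicClass

/-! ### Tangent disks and tubes around the surfaces `|z_l| = e^{A_l} |ζ|^{a_l}`. -/

theorem abs_log_norm_one_add_sub_re_le {z : ℂ} (hz : ‖z‖ ≤ 1 / 2) :
    |Real.log ‖1 + z‖ - z.re| ≤ ‖z‖ ^ 2 := by
  have h := Complex.norm_log_one_add_sub_self_le (z := z) (by linarith)
  have h1 : (1 - ‖z‖)⁻¹ ≤ 2 := by
    rw [inv_le_comm₀ (by linarith) two_pos]
    linarith
  have h2 : ‖Complex.log (1 + z) - z‖ ≤ ‖z‖ ^ 2 := by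
    refine h.trans ?_
    have := mul_le_mul_of_nonneg_left h1 (sq_nonneg ‖z‖)
    linarith
  have h3 := (Complex.abs_re_le_norm (Complex.log (1 + z) - z)).trans h2
  rwa [Complex.sub_re, Complex.log_re] at h3

/-- The perturbation of `log |z| - a log |ζ|` along the disk with direction `ε (a z, ζ)`. -/
theorem abs_log_norm_sub_mul_log_norm_le {a ε : ℝ} (hε : 0 ≤ ε) (ha : ε * (1 + |a|) ≤ 1 / 2)
    {ζ : ℂ} (hζ : ‖ζ‖ ≤ 1) :
    |Real.log ‖1 + ζ * ((a * ε : ℝ) : ℂ)‖ - a * Real.log ‖1 + ζ * (ε : ℂ)‖| ≤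
      (a ^ 2 + |a|) * ε ^ 2 := by
  have hεa : 0 ≤ ε * |a| := by positivity
  have hn1 : ‖ζ * ((a * ε : ℝ) : ℂ)‖ ≤ |a| * ε := by
    rw [norm_mul, Complex.norm_real, Real.norm_eq_abs, abs_mul, abs_of_nonneg hε]
    exact mul_le_of_le_one_left (by positivity) hζ
  have hn2 : ‖ζ * (ε : ℂ)‖ ≤ ε := by
    rw [norm_mul, Complex.norm_real, Real.norm_of_nonneg hε]
    exact mul_le_of_le_one_left hε hζ
  have h1 := (abs_log_norm_one_add_sub_re_le (z := ζ * ((a * ε : ℝ) : ℂ)) (by linarith)).trans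
    (pow_le_pow_left₀ (norm_nonneg _) hn1 2)
  have h2 := (abs_log_norm_one_add_sub_re_le (z := ζ * (ε : ℂ)) (by linarith)).trans
    (pow_le_pow_left₀ (norm_nonneg _) hn2 2)
  have e1 : (ζ * ((a * ε : ℝ) : ℂ)).re = a * (ζ * (ε : ℂ)).re := by
    simp only [Complex.re_mul_ofReal]
    ring
  rw [e1] at h1
  set p := Real.log ‖1 + ζ * ((a * ε : ℝ) : ℂ)‖
  set q := Real.log ‖1 + ζ * (ε : ℂ)‖
  set r := (ζ * (ε : ℂ)).re
  have e2 : p - a * q = (p - a * r) - a * (q - r) := by ring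
  rw [e2]
  refine (abs_sub _ _).trans ?_
  rw [abs_mul]
  have h3 := mul_le_mul_of_nonneg_left h2 (abs_nonneg a)
  rw [mul_pow, sq_abs] at h1
  linarith

/-- The perturbation is harmonic and vanishes at the centre, so the cross term with `p` averages to
zero. Only its square remains, which is of order `ε⁴` because the first-order terms cancel. -/
theorem circleAverage_sq_log_norm_le {a ε : ℝ} (hε : 0 ≤ ε) (ha : ε * (1 + |a|) ≤ 1 / 2)
    (p : ℝ) : Real.circleAverage (fun ζ : ℂ => (p + (Real.log ‖1 + ζ * ((a * ε : ℝ) : ℂ)‖ -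
      a * Real.log ‖1 + ζ * (ε : ℂ)‖)) ^ 2) 0 1 ≤ p ^ 2 + ((a ^ 2 + |a|) * ε ^ 2) ^ 2 := by
  have hεa : 0 ≤ ε * |a| := by positivity
  have hn1 : ‖((a * ε : ℝ) : ℂ)‖ < ‖(1 : ℂ)‖ := by
    rw [Complex.norm_real, Real.norm_eq_abs, abs_mul, abs_of_nonneg hε, norm_one]
    linarith
  have hn2 : ‖(ε : ℂ)‖ < ‖(1 : ℂ)‖ := by
    rw [Complex.norm_real, Real.norm_of_nonneg hε, norm_one]
    linarith
  have hc : ∀ d : ℂ, ‖d‖ < ‖(1 : ℂ)‖ → ContinuousOn (fun ζ : ℂ => Real.log ‖1 + ζ * d‖)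
      (Metric.sphere 0 1) := by
    intro d hd
    refine ContinuousOn.log (by fun_prop) fun ζ hζ h => ?_
    rw [norm_eq_zero, add_eq_zero_iff_eq_neg] at h
    have h1 : ‖ζ‖ = 1 := by simpa using hζ
    rw [h, norm_neg, norm_mul, h1, one_mul] at hd
    exact lt_irrefl _ hd
  set q : ℂ → ℝ := fun ζ => Real.log ‖1 + ζ * ((a * ε : ℝ) : ℂ)‖ - a * Real.log ‖1 + ζ * (ε : ℂ)‖
    with hq
  have hqc : ContinuousOn q (Metric.sphere 0 1) :=
    (hc _ hn1).sub (continuousOn_const.mul (hc _ hn2))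
  have hqi : CircleIntegrable q 0 1 := hqc.circleIntegrable zero_le_one
  have hqa : CircleIntegrable (fun ζ => a * Real.log ‖1 + ζ * (ε : ℂ)‖) 0 1 :=
    (circleIntegrable_log_norm_add_mul _ _).const_mul a
  have hq0 : Real.circleAverage q 0 1 = 0 := by
    rw [hq, Real.circleAverage_fun_sub (circleIntegrable_log_norm_add_mul _ _) hqa, circleAverage_const_mul,
      circleAverage_log_norm_of_norm_lt hn1, circleAverage_log_norm_of_norm_lt hn2]
    simp
  set B := ((a ^ 2 + |a|) * ε ^ 2) ^ 2
  have hi : CircleIntegrable (fun ζ => 2 * p * q ζ) 0 1 := hqi.const_mul _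
  have hmono : Real.circleAverage (fun ζ => (p + q ζ) ^ 2) 0 1 ≤
      Real.circleAverage (fun ζ => (p ^ 2 + B) + 2 * p * q ζ) 0 1 := by
    refine Real.circleAverage_mono (((continuousOn_const.add hqc).pow 2).circleIntegrable
      zero_le_one) ((circleIntegrable_const _ _ _).add hi) fun ζ hζ => ?_
    have h1 : ‖ζ‖ ≤ 1 := by
      have : ‖ζ‖ = 1 := by simpa using hζ
      exact this.le
    have h2 : q ζ ^ 2 ≤ B := sq_le_sq' (neg_le_of_abs_le
      (abs_log_norm_sub_mul_log_norm_le hε ha h1))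
      (le_of_abs_le (abs_log_norm_sub_mul_log_norm_le hε ha h1))
    nlinarith
  refine hmono.trans_eq ?_
  rw [Real.circleAverage_fun_add (circleIntegrable_const _ _ _) hi, Real.circleAverage_const,
    circleAverage_const_mul, hq0]
  ring

section LogTube

variable {n : ℕ}

/-- The logarithmic deviation of `|v₁|` from `e^A |v₂|^a`. -/
noncomputable def logDefect (A a : Fin n → ℝ) (v : (Fin n → ℂ) × ℂ) (l : Fin n) : ℝ :=
  Real.log ‖v.1 l‖ - A l - a l * Real.log ‖v.2‖

/-- A tube around the real surfaces `|z_l| = e^{A_l} |ζ|^{a_l}`, `l ∉ I`, `z_l = 0`, `l ∈ I`. -/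
def logTube (I : Set (Fin n)) (A a : Fin n → ℝ) (r x₀ x₁ : ℝ) : Set ((Fin n → ℂ) × ℂ) :=
  {v | (v.2 ≠ 0 ∧ x₀ ≤ Real.log ‖v.2‖ ∧ Real.log ‖v.2‖ ≤ x₁) ∧
    ∀ l, (v.1 l = 0 ↔ l ∈ I) ∧ |logDefect A a v l| ≤ r}

variable {I : Set (Fin n)} {A a : Fin n → ℝ} {r x₀ x₁ : ℝ}

theorem continuousOn_logDefect (l : Fin n) :
    ContinuousOn (fun v => logDefect A a v l) (logTube I A a r x₀ x₁) := by
  have h2 : ContinuousOn (fun v : (Fin n → ℂ) × ℂ => a l * Real.log ‖v.2‖)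
      (logTube I A a r x₀ x₁) :=
    continuousOn_const.mul (ContinuousOn.log (by fun_prop) fun v hv => norm_ne_zero_iff.2 hv.1.1)
  by_cases hl : l ∈ I
  · refine ContinuousOn.congr (continuousOn_const (c := Real.log 0 - A l) |>.sub h2) fun v hv => ?_
    rw [logDefect, ((hv.2 l).1).2 hl, norm_zero]
    rfl
  · refine (ContinuousOn.sub (ContinuousOn.log (by fun_prop) fun v hv => ?_)
      continuousOn_const).sub h2
    rw [norm_ne_zero_iff]
    exact fun h => hl ((hv.2 l).1.1 h)

/-- For `l ∉ I` the bound on the defect keeps `|z_l|` above a positive continuous function, so the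
condition `z_l ≠ 0` costs no closedness. For `l ∈ I` the defect vanishes, since `Real.log 0 = 0` and
`A l = a l = 0`. -/
theorem isCompact_logTube (hA : ∀ l ∈ I, A l = 0) (ha : ∀ l ∈ I, a l = 0) (hr : 0 ≤ r) :
    IsCompact (logTube I A a r x₀ x₁) := by
  classical
  let B : Set ((Fin n → ℂ) × ℂ) := {v | Real.exp x₀ ≤ ‖v.2‖ ∧ ‖v.2‖ ≤ Real.exp x₁}
  have hn : Continuous fun v : (Fin n → ℂ) × ℂ => ‖v.2‖ := by fun_prop
  have hBc : IsClosed B := (isClosed_le continuous_const hn).inter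
    (isClosed_le hn continuous_const)
  have hB0 : ∀ v ∈ B, v.2 ≠ 0 := fun v hv => norm_pos_iff.1 ((Real.exp_pos _).trans_le hv.1)
  have hBx : ∀ v : (Fin n → ℂ) × ℂ, v.2 ≠ 0 ∧ x₀ ≤ Real.log ‖v.2‖ ∧ Real.log ‖v.2‖ ≤ x₁ ↔ v ∈ B := by
    intro v
    constructor
    · rintro ⟨h0, h1, h2⟩
      exact ⟨(Real.le_log_iff_exp_le (norm_pos_iff.2 h0)).1 h1,
        (Real.log_le_iff_le_exp (norm_pos_iff.2 h0)).1 h2⟩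
    · intro hv
      have h0 := norm_pos_iff.2 (hB0 v hv)
      exact ⟨hB0 v hv, (Real.le_log_iff_exp_le h0).2 hv.1, (Real.log_le_iff_le_exp h0).2 hv.2⟩
  have hcont : ∀ l (c : ℝ), ContinuousOn (fun v : (Fin n → ℂ) × ℂ =>
      Real.exp (A l + a l * Real.log ‖v.2‖ + c)) B := fun l c =>
    Real.continuous_exp.comp_continuousOn ((continuousOn_const.add (continuousOn_const.mul
      (ContinuousOn.log (by fun_prop) fun v hv => norm_ne_zero_iff.2 (hB0 v hv)))).add
        continuousOn_const)
  let S : Fin n → Set ((Fin n → ℂ) × ℂ) := fun l =>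
    if l ∈ I then {v | v.1 l = 0} else
      {v ∈ B | Real.exp (A l + a l * Real.log ‖v.2‖ + -r) ≤ ‖v.1 l‖} ∩
        {v ∈ B | ‖v.1 l‖ ≤ Real.exp (A l + a l * Real.log ‖v.2‖ + r)}
  have hS : ∀ l, IsClosed (S l) := by
    intro l
    by_cases hl : l ∈ I
    · simp only [S, if_pos hl]
      exact isClosed_eq (by fun_prop) continuous_const
    · simp only [S, if_neg hl]
      exact (hBc.isClosed_le (hcont l _) (by fun_prop)).inter
        (hBc.isClosed_le (by fun_prop) (hcont l _))
  have heq : logTube I A a r x₀ x₁ = B ∩ ⋂ l, S l := by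
    ext v
    simp only [logTube, mem_ofPred_eq, mem_inter_iff, mem_iInter, hBx]
    refine and_congr_right fun hv => forall_congr' fun l => ?_
    by_cases hl : l ∈ I
    · simp only [S, if_pos hl, hl, iff_true, mem_ofPred_eq, and_iff_left_iff_imp]
      intro h
      simpa [logDefect, h, hA l hl, ha l hl] using hr
    · simp only [S, if_neg hl, hl, iff_false, mem_inter_iff, mem_ofPred_eq, hv, true_and]
      constructor
      · rintro ⟨h0, h⟩
        have hp := norm_pos_iff.2 h0
        rw [logDefect, abs_le] at h
        exact ⟨(Real.le_log_iff_exp_le hp).1 (by linarith [h.1]),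
          (Real.log_le_iff_le_exp hp).1 (by linarith [h.2])⟩
      · rintro ⟨h1, h2⟩
        have hp := (Real.exp_pos _).trans_le h1
        refine ⟨norm_pos_iff.1 hp, abs_le.2 ⟨?_, ?_⟩⟩
        · have := (Real.le_log_iff_exp_le hp).2 h1
          rw [logDefect]
          linarith
        · have := (Real.log_le_iff_le_exp hp).2 h2
          rw [logDefect]
          linarith
  have hbox : IsCompact ((univ.pi fun l => Metric.closedBall (0 : ℂ)
      (Real.exp (A l + |a l| * max |x₀| |x₁| + r))) ×ˢ Metric.closedBall (0 : ℂ) (Real.exp x₁)) :=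
    (isCompact_univ_pi fun l => isCompact_closedBall _ _).prod (isCompact_closedBall _ _)
  refine hbox.of_isClosed_subset ?_ ?_
  · rw [heq]
    exact hBc.inter (isClosed_iInter hS)
  · rintro v hv
    refine ⟨fun l _ => ?_, by simpa using ((hBx v).1 hv.1).2⟩
    rw [mem_closedBall_zero_iff]
    by_cases h0 : v.1 l = 0
    · rw [h0, norm_zero]
      exact (Real.exp_pos _).le
    · refine (Real.log_le_iff_le_exp (norm_pos_iff.2 h0)).1 ?_
      have h1 := le_of_abs_le (hv.2 l).2
      have h2 : a l * Real.log ‖v.2‖ ≤ |a l| * max |x₀| |x₁| := by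
        refine (le_abs_self _).trans ?_
        rw [abs_mul]
        exact mul_le_mul_of_nonneg_left (abs_le_max_abs_abs hv.1.2.1 hv.1.2.2) (abs_nonneg _)
      rw [logDefect] at h1
      linarith

/-- Through every interior point of the tube passes a disk in the tube along which the
squared deviation is supermean up to an error of higher order than that of `|ζ|²`. -/
theorem exists_disk_logTube (ha : ∀ l ∈ I, a l = 0) {v : (Fin n → ℂ) × ℂ}
    (hv : v ∈ logTube I A a r x₀ x₁) (h0 : x₀ < Real.log ‖v.2‖) (h1 : Real.log ‖v.2‖ < x₁)
    (hlt : ∀ l, |logDefect A a v l| < r) {α β δ N : ℝ} (hδ : 0 < δ) (hN : 0 ≤ N) :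
    ∃ b : (Fin n → ℂ) × ℂ, (∀ ζ : ℂ, ‖ζ‖ ≤ 1 → v + ζ • b ∈ logTube I A a r x₀ x₁) ∧
      Real.circleAverage (fun ζ : ℂ => α + β * Real.log ‖(v + ζ • b).2‖ +
        δ * (9 - ‖(v + ζ • b).2‖ ^ 2) + N * ∑ l, logDefect A a (v + ζ • b) l ^ 2) 0 1 <
      α + β * Real.log ‖v.2‖ + δ * (9 - ‖v.2‖ ^ 2) + N * ∑ l, logDefect A a v l ^ 2 := by
  have hv0 : 0 < ‖v.2‖ := norm_pos_iff.2 hv.1.1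
  have hsmall : ∀ (f : ℝ → ℝ) (c : ℝ), Continuous f → f 0 < c → ∀ᶠ ε in 𝓝[>] (0 : ℝ), f ε < c :=
    fun f c hf h => eventually_nhdsWithin_of_eventually_nhds
      (hf.continuousAt.eventually (gt_mem_nhds h))
  have e1 := eventually_all.2 fun l => hsmall (fun ε => ε * (1 + |a l|)) (1 / 2) (by fun_prop)
    (by norm_num)
  have e2 := hsmall (fun ε => 2 * ε) (Real.log ‖v.2‖ - x₀) (by fun_prop) (by simpa using h0)
  have e3 := hsmall (fun ε => 2 * ε) (x₁ - Real.log ‖v.2‖) (by fun_prop) (by simpa using h1)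
  have e4 := eventually_all.2 fun l => hsmall (fun ε => (a l ^ 2 + |a l|) * ε ^ 2)
    (r - |logDefect A a v l|) (by fun_prop) (by simpa using hlt l)
  -- After multiplication by `ε²`: the fourth-order loss from the squared defects stays below the
  -- second-order gain from `-δ |ζ|²`.
  have e5 := hsmall (fun ε => N * (∑ l, (a l ^ 2 + |a l|) ^ 2) * ε ^ 2) (δ * ‖v.2‖ ^ 2)
    (by fun_prop) (by simpa using mul_pos hδ (pow_pos hv0 2))
  have e6 := hsmall (fun ε => ε) (1 / 2) (by fun_prop) (by norm_num)
  obtain ⟨ε, ⟨⟨⟨⟨⟨he1, he2⟩, he3⟩, he4⟩, he5⟩, he6⟩, hε⟩ :=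
    ((((((e1.and e2).and e3).and e4).and e5).and e6).and self_mem_nhdsWithin).exists
  have hε0 : 0 < ε := hε
  have hεn : ‖(ε : ℂ)‖ = ε := by rw [Complex.norm_real, Real.norm_of_nonneg hε0.le]
  -- Tangent at `v` to the leaf `z_l = C_l ζ^{a_l}`; the multiplicative form fixes vanishing
  -- coordinates.
  let b : (Fin n → ℂ) × ℂ := (fun l => v.1 l * ((a l * ε : ℝ) : ℂ), v.2 * (ε : ℂ))
  have hb1 : ∀ (ζ : ℂ) l, (v + ζ • b).1 l = v.1 l * (1 + ζ * ((a l * ε : ℝ) : ℂ)) := fun ζ l => by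
    simp only [b, Prod.fst_add, Prod.smul_fst, Pi.add_apply, Pi.smul_apply, smul_eq_mul]
    ring
  have hb2 : ∀ ζ : ℂ, (v + ζ • b).2 = v.2 * (1 + ζ * (ε : ℂ)) := fun ζ => by
    simp only [b, Prod.snd_add, Prod.smul_snd, smul_eq_mul]
    ring
  have hne : ∀ ζ d : ℂ, ‖ζ‖ ≤ 1 → ‖d‖ < 1 → 1 + ζ * d ≠ 0 := by
    intro ζ d hζ hd h
    rw [add_eq_zero_iff_eq_neg] at h
    have h2 : ‖ζ * d‖ = 1 := by rw [← norm_neg, ← h, norm_one]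
    rw [norm_mul] at h2
    nlinarith [norm_nonneg d, norm_nonneg ζ]
  have hnε : ‖(ε : ℂ)‖ < 1 := by rw [hεn]; linarith
  have hna : ∀ l, ‖((a l * ε : ℝ) : ℂ)‖ < 1 := fun l => by
    rw [Complex.norm_real, Real.norm_eq_abs, abs_mul, abs_of_pos hε0]
    linarith [he1 l]
  have hlog2 : ∀ ζ : ℂ, ‖ζ‖ ≤ 1 →
      Real.log ‖(v + ζ • b).2‖ = Real.log ‖v.2‖ + Real.log ‖1 + ζ * (ε : ℂ)‖ := fun ζ hζ => by
    rw [hb2, norm_mul, Real.log_mul hv0.ne' (norm_ne_zero_iff.2 (hne ζ _ hζ hnε))]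
  have hdef : ∀ (ζ : ℂ) l, ‖ζ‖ ≤ 1 → logDefect A a (v + ζ • b) l = logDefect A a v l +
      (Real.log ‖1 + ζ * ((a l * ε : ℝ) : ℂ)‖ - a l * Real.log ‖1 + ζ * (ε : ℂ)‖) := by
    intro ζ l hζ
    rw [logDefect, logDefect, hlog2 ζ hζ, hb1]
    by_cases hl : v.1 l = 0
    · simp [hl, ha l ((hv.2 l).1.1 hl)]
    · rw [norm_mul, Real.log_mul (norm_ne_zero_iff.2 hl)
        (norm_ne_zero_iff.2 (hne ζ _ hζ (hna l)))]
      ring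
  have hmem : ∀ ζ : ℂ, ‖ζ‖ ≤ 1 → v + ζ • b ∈ logTube I A a r x₀ x₁ := by
    intro ζ hζ
    have hsm : |Real.log ‖1 + ζ * (ε : ℂ)‖| ≤ 2 * ε := by
      have hn : ‖ζ * (ε : ℂ)‖ ≤ ε := by
        rw [norm_mul, hεn]
        exact mul_le_of_le_one_left hε0.le hζ
      have h3 := abs_log_norm_one_add_sub_re_le (z := ζ * (ε : ℂ)) (by linarith)
      have h4 := Complex.abs_re_le_norm (ζ * (ε : ℂ))
      have h5 : ‖ζ * (ε : ℂ)‖ ^ 2 ≤ ε := by nlinarith [norm_nonneg (ζ * (ε : ℂ))]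
      rw [abs_le] at h3 h4 ⊢
      constructor <;> linarith [h3.1, h3.2, h4.1, h4.2]
    refine ⟨⟨?_, ?_, ?_⟩, fun l => ⟨?_, ?_⟩⟩
    · rw [hb2]
      exact mul_ne_zero hv.1.1 (hne ζ _ hζ hnε)
    · rw [hlog2 ζ hζ]
      linarith [neg_le_of_abs_le hsm]
    · rw [hlog2 ζ hζ]
      linarith [le_of_abs_le hsm]
    · rw [hb1, mul_eq_zero, or_iff_left (hne ζ _ hζ (hna l))]
      exact (hv.2 l).1
    · rw [hdef ζ l hζ]
      refine (abs_add_le _ _).trans ?_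
      linarith [abs_log_norm_sub_mul_log_norm_le hε0.le (he1 l).le hζ, he4 l]
  refine ⟨b, hmem, ?_⟩
  have hcd : ∀ l, ContinuousOn (fun ζ : ℂ => logDefect A a (v + ζ • b) l ^ 2)
      (Metric.sphere 0 1) := fun l =>
    ((continuousOn_logDefect l).comp (by fun_prop) fun ζ hζ =>
      hmem ζ (mem_sphere_zero_iff_norm.1 hζ).le).pow 2
  have hi1 : CircleIntegrable (fun ζ : ℂ => β * Real.log ‖(v + ζ • b).2‖) 0 1 := by
    have : CircleIntegrable (fun ζ : ℂ => β * Real.log ‖v.2 + ζ * b.2‖) 0 1 :=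
      (circleIntegrable_log_norm_add_mul v.2 b.2).const_mul β
    exact this
  have hi2 : CircleIntegrable (fun ζ : ℂ => α + β * Real.log ‖(v + ζ • b).2‖) 0 1 :=
    (circleIntegrable_const α 0 1).add hi1
  have hi3 : CircleIntegrable (fun ζ : ℂ => ‖(v + ζ • b).2‖ ^ 2) 0 1 :=
    Continuous.continuousOn (by fun_prop) |>.circleIntegrable zero_le_one
  have hi4 : CircleIntegrable (fun ζ : ℂ => 9 - ‖(v + ζ • b).2‖ ^ 2) 0 1 :=
    (circleIntegrable_const 9 0 1).sub hi3
  have hi5 : CircleIntegrable (fun ζ : ℂ => δ * (9 - ‖(v + ζ • b).2‖ ^ 2)) 0 1 := hi4.const_mul δ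
  have hi6 : ∀ l, CircleIntegrable (fun ζ : ℂ => logDefect A a (v + ζ • b) l ^ 2) 0 1 := fun l =>
    (hcd l).circleIntegrable zero_le_one
  have hi7 : CircleIntegrable (fun ζ : ℂ => ∑ l, logDefect A a (v + ζ • b) l ^ 2) 0 1 :=
    CircleIntegrable.fun_sum _ fun l _ => hi6 l
  have hi8 : CircleIntegrable (fun ζ : ℂ => N * ∑ l, logDefect A a (v + ζ • b) l ^ 2) 0 1 :=
    hi7.const_mul N
  have hi9 : CircleIntegrable (fun ζ : ℂ => α + β * Real.log ‖(v + ζ • b).2‖ +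
      δ * (9 - ‖(v + ζ • b).2‖ ^ 2)) 0 1 := hi2.add hi5
  have hbn : ‖b.2‖ = ‖v.2‖ * ε := by simp only [b]; rw [norm_mul, hεn]
  have hA1 : Real.circleAverage (fun ζ : ℂ => Real.log ‖(v + ζ • b).2‖) 0 1 =
      Real.log ‖v.2‖ := by
    have := circleAverage_log_norm_of_norm_lt (c := v.2) (d := b.2) (by
      rw [hbn]; nlinarith)
    simpa using this
  have hA2 : Real.circleAverage (fun ζ : ℂ => ‖(v + ζ • b).2‖ ^ 2) 0 1 =
      ‖v.2‖ ^ 2 + (‖v.2‖ * ε) ^ 2 := by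
    have := circleAverage_norm_add_mul_sq v.2 b.2
    rw [hbn] at this
    simpa using this
  have hA3 : ∀ l, Real.circleAverage (fun ζ : ℂ => logDefect A a (v + ζ • b) l ^ 2) 0 1 ≤
      logDefect A a v l ^ 2 + (a l ^ 2 + |a l|) ^ 2 * ε ^ 4 := by
    intro l
    have h := circleAverage_sq_log_norm_le hε0.le (he1 l).le (logDefect A a v l)
    rw [Real.circleAverage_congr_sphere (f₂ := fun ζ : ℂ => (logDefect A a v l +
      (Real.log ‖1 + ζ * ((a l * ε : ℝ) : ℂ)‖ - a l * Real.log ‖1 + ζ * (ε : ℂ)‖)) ^ 2)]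
    · refine h.trans_eq (by ring)
    · intro ζ hζ
      have h1 : ‖ζ‖ ≤ 1 := by
        have : ‖ζ‖ = 1 := by simpa using hζ
        exact this.le
      simp only [hdef ζ l h1]
  rw [Real.circleAverage_fun_add hi9 hi8, Real.circleAverage_fun_add hi2 hi5,
    Real.circleAverage_fun_add (circleIntegrable_const _ _ _) hi1, circleAverage_const_mul,
    circleAverage_const_mul, circleAverage_const_mul,
    Real.circleAverage_fun_sub (circleIntegrable_const _ _ _) hi3, Real.circleAverage_const,
    Real.circleAverage_const, hA1, hA2, Real.circleAverage_fun_sum fun l _ => hi6 l]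
  have hsum : N * ∑ l, Real.circleAverage (fun ζ : ℂ => logDefect A a (v + ζ • b) l ^ 2) 0 1 ≤
      N * (∑ l, logDefect A a v l ^ 2) + N * (∑ l, (a l ^ 2 + |a l|) ^ 2) * ε ^ 4 := by
    rw [mul_assoc, ← mul_add, Finset.sum_mul, ← Finset.sum_add_distrib]
    exact mul_le_mul_of_nonneg_left (Finset.sum_le_sum fun l _ => hA3 l) hN
  have h5 := mul_lt_mul_of_pos_right he5 (pow_pos hε0 2)
  nlinarith

end LogTube

/-! ### The upper bound on the geometric mean. -/

section UpperBound

variable {n : ℕ} {K₀ K₁ : Set (Fin n → ℂ)} {t : ℝ}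

/-- If `z l = 0`, both factors may be given zero `l`-th coordinate, since moduli may be lowered.
This aligns the zeros, so that the remaining coordinates have genuine logarithms. -/
theorem exists_mem_of_mem_geometricMean (h₀ : IsCompleteLogConvex K₀) (hc₀ : IsClosed K₀)
    (hs₀ : K₀ ⊆ unitPolydisk n) (hR₀ : IsReinhardt K₀) (h₁ : IsCompleteLogConvex K₁)
    (hc₁ : IsClosed K₁) (hs₁ : K₁ ⊆ unitPolydisk n) (hR₁ : IsReinhardt K₁) (ht0 : 0 < t)
    (ht1 : t < 1) {z : Fin n → ℂ} (hz : z ∈ geometricMean K₀ K₁ t) :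
    ∃ η ∈ K₀, ∃ ξ ∈ K₁, (∀ l, η l = 0 ↔ z l = 0) ∧ (∀ l, ξ l = 0 ↔ z l = 0) ∧
      ∀ l, ‖z l‖ = ‖η l‖ ^ (1 - t) * ‖ξ l‖ ^ t := by
  classical
  obtain ⟨η, hη, ξ, hξ, he⟩ := hz
  have hzero : ∀ l, z l ≠ 0 → η l ≠ 0 ∧ ξ l ≠ 0 := by
    intro l hl
    rw [← norm_ne_zero_iff, he l] at hl
    constructor
    · intro h
      simp [h, Real.zero_rpow (by linarith : 1 - t ≠ 0)] at hl
    · intro h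
      simp [h, Real.zero_rpow ht0.ne'] at hl
  refine ⟨fun l => if z l = 0 then 0 else η l, h₀.mem_of_norm_le hc₀ hs₀ hR₀ hη fun l => ?_,
    fun l => if z l = 0 then 0 else ξ l, h₁.mem_of_norm_le hc₁ hs₁ hR₁ hξ fun l => ?_,
    fun l => ?_, fun l => ?_, fun l => ?_⟩
  · split_ifs <;> simp
  · split_ifs <;> simp
  · by_cases hl : z l = 0
    · simp [hl]
    · simp [hl, (hzero l hl).1]
  · by_cases hl : z l = 0
    · simp [hl]
    · simp [hl, (hzero l hl).2]
  · by_cases hl : z l = 0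
    · simp [hl, Real.zero_rpow ht0.ne']
    · simp [hl, he l]

theorem le_of_mem_geodesicClass_of_mem_geometricMean
    (hc₀ : IsCompact K₀) (hc₁ : IsCompact K₁)
    (hs₀ : K₀ ⊆ unitPolydisk n) (hs₁ : K₁ ⊆ unitPolydisk n)
    (hR₀ : IsReinhardt K₀) (hR₁ : IsReinhardt K₁)
    (h₀ : IsCompleteLogConvex K₀) (h₁ : IsCompleteLogConvex K₁)
    {c₀ c₁ : ℝ} (hp₀ : 0 < c₀) (hp₁ : 0 < c₁) (ht0 : 0 < t) (ht1 : t < 1)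
    {u : (Fin n → ℂ) × ℂ → EReal}
    (hu : u ∈ geodesicClass (unitPolydisk n)
      (fun z => (c₀ : EReal) * relExtremal (unitPolydisk n) K₀ z)
      (fun z => (c₁ : EReal) * relExtremal (unitPolydisk n) K₁ z))
    {z : Fin n → ℂ} (hz : z ∈ geometricMean K₀ K₁ t) :
    u (z, (Real.exp t : ℂ)) ≤ ((-((1 - t) * c₀ + t * c₁) : ℝ) : EReal) := by
  obtain ⟨η, hη, ξ, hξ, hη0, hξ0, he⟩ := exists_mem_of_mem_geometricMean h₀ hc₀.isClosed hs₀ hR₀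
    h₁ hc₁.isClosed hs₁ hR₁ ht0 ht1 hz
  let I : Set (Fin n) := {l | z l = 0}
  let A : Fin n → ℝ := fun l => Real.log ‖η l‖
  let a : Fin n → ℝ := fun l => Real.log ‖ξ l‖ - Real.log ‖η l‖
  have hA : ∀ l ∈ I, A l = 0 := fun l hl => by simp [A, (hη0 l).2 hl]
  have ha : ∀ l ∈ I, a l = 0 := fun l hl => by simp [a, (hη0 l).2 hl, (hξ0 l).2 hl]
  -- The comparison function exceeds the target at `(z, e^t)` by at most `9δ`; the constant `9`
  -- works because `|ζ|² ≤ e² ≤ 8` on the tube.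
  apply EReal.le_coe_of_forall_pos (k := 9)
  intro δ hδ
  obtain ⟨e, he0, hec⟩ : ∃ e : ℝ, 0 < e ∧ (c₀ + c₁) * e = δ / 4 :=
    ⟨δ / 4 / (c₀ + c₁), by positivity, by field_simp⟩
  obtain ⟨σ₀, hσ₀, hω₀⟩ := exists_relExtremal_le h₀ hc₀ hs₀ hR₀ he0
  obtain ⟨σ₁, hσ₁, hω₁⟩ := exists_relExtremal_le h₁ hc₁ hs₁ hR₁ he0
  obtain ⟨r, hr, hr₀, hr₁⟩ : ∃ r > 0, 2 * r ≤ σ₀ ∧ 2 * r ≤ σ₁ := by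
    refine ⟨min σ₀ σ₁ / 2, by positivity, ?_, ?_⟩
    · linarith [min_le_left σ₀ σ₁]
    · linarith [min_le_right σ₀ σ₁]
  have hsmall : ∀ k c : ℝ, 0 < c → ∀ᶠ x in 𝓝[>] (0 : ℝ), k * x < c := fun k c hc =>
    eventually_nhdsWithin_of_eventually_nhds ((by fun_prop : Continuous fun x : ℝ => k * x
      ).continuousAt.eventually (gt_mem_nhds (by simpa using hc)))
  -- With `|a l| x₀ < r`, the end slices of the tube lie within a factor `e^{2r}` of `η` and `ξ`,
  -- where the extremal functions are at most `-1 + e`; the interpolation error there is below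
  -- `δ/4`.
  obtain ⟨x₀, ⟨⟨⟨hx1, hx2⟩, hx3⟩, hx4⟩, hx0 : 0 < x₀⟩ :=
    (((((eventually_all.2 fun l => hsmall |a l| r hr).and (hsmall (c₀ + c₁) (δ / 4) (by positivity))
      ).and (hsmall 1 t ht0)).and (hsmall 1 (1 - t) (by linarith))).and self_mem_nhdsWithin).exists
  rw [one_mul] at hx3 hx4
  set T := logTube I A a r x₀ (1 - x₀) with hT
  have hupper : ∀ v ∈ T, ∀ l, v.1 l ≠ 0 →
      Real.log ‖v.1 l‖ ≤ A l + a l * Real.log ‖v.2‖ + r := fun v hv l _ => by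
    have := le_of_abs_le (hv.2 l).2
    rw [logDefect] at this
    linarith
  -- With the next bound this keeps the tube in the polydisk: `A l + a l x + r` is affine in `x` and
  -- negative at `0` and at `1`.
  have hAr : ∀ l, z l ≠ 0 → A l + r < 0 := by
    intro l hl
    have hpos : 0 < ‖η l‖ := norm_pos_iff.2 fun h => hl ((hη0 l).1 h)
    have h := (hω₀ η hη (fun l => (Real.exp r : ℂ) * η l) fun l => by
      rw [norm_mul, Complex.norm_real, Real.norm_of_nonneg (Real.exp_pos _).le]
      gcongr
      linarith).1 l
    rw [norm_mul, Complex.norm_real, Real.norm_of_nonneg (Real.exp_pos _).le] at h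
    have h2 := Real.log_neg (by positivity) h
    rw [Real.log_mul (Real.exp_pos _).ne' hpos.ne', Real.log_exp] at h2
    simp only [A]
    linarith
  have hBr : ∀ l, z l ≠ 0 → A l + a l + r < 0 := by
    intro l hl
    have hpos : 0 < ‖ξ l‖ := norm_pos_iff.2 fun h => hl ((hξ0 l).1 h)
    have h := (hω₁ ξ hξ (fun l => (Real.exp r : ℂ) * ξ l) fun l => by
      rw [norm_mul, Complex.norm_real, Real.norm_of_nonneg (Real.exp_pos _).le]
      gcongr
      linarith).1 l
    rw [norm_mul, Complex.norm_real, Real.norm_of_nonneg (Real.exp_pos _).le] at h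
    have h2 := Real.log_neg (by positivity) h
    rw [Real.log_mul (Real.exp_pos _).ne' hpos.ne', Real.log_exp] at h2
    simp only [A, a]
    linarith
  have hTx : ∀ v ∈ T, 0 < Real.log ‖v.2‖ ∧ Real.log ‖v.2‖ < 1 := fun v hv =>
    ⟨by linarith [hv.1.2.1], by linarith [hv.1.2.2]⟩
  have hTΩ : ∀ v ∈ T, v.1 ∈ unitPolydisk n := by
    intro v hv l
    by_cases hl : v.1 l = 0
    · simp [hl]
    have hzl : z l ≠ 0 := fun h => hl ((hv.2 l).1.2 h)
    have hlog : Real.log ‖v.1 l‖ < 0 := by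
      have h1 := hupper v hv l hl
      obtain ⟨h2, h3⟩ := hTx v hv
      nlinarith [hAr l hzl, hBr l hzl]
    exact (Real.log_neg_iff (norm_pos_iff.2 hl)).1 hlog
  have hTA : ∀ v ∈ T, v ∈ unitPolydisk n ×ˢ annulus := fun v hv =>
    ⟨hTΩ v hv, hv.1.1, (hTx v hv).1, (hTx v hv).2⟩
  have hbound : ∀ v ∈ T, ∃ p q : ℝ, u v ≤ ((c₀ * p + (c₁ * q - c₀ * p) * Real.log ‖v.2‖ : ℝ) : EReal)
      ∧ p ≤ 0 ∧ q ≤ 0 ∧ relExtremal (unitPolydisk n) K₀ v.1 = p ∧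
        relExtremal (unitPolydisk n) K₁ v.1 = q := by
    intro v hv
    obtain ⟨p, hp, -, hp0⟩ := exists_coe_eq_relExtremal (K := K₀) (hTΩ v hv)
    obtain ⟨q, hq, -, hq0⟩ := exists_coe_eq_relExtremal (K := K₁) (hTΩ v hv)
    refine ⟨p, q, ?_, hp0, hq0, hp, hq⟩
    exact le_interpolation_of_mem_geodesicClass hu (hTΩ v hv) (a := c₀ * p) (b := c₁ * q)
      (by simp only [hp, EReal.coe_mul]) (by simp only [hq, EReal.coe_mul]) (hTA v hv).2
  -- On the lateral boundary, where some defect is `±r`, the penalty is at least `c₀ + c₁`, which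
  -- makes `H` positive while `u ≤ 0`.
  let N : ℝ := (c₀ + c₁) / r ^ 2
  have hN : 0 ≤ N := by positivity
  let H : (Fin n → ℂ) × ℂ → ℝ := fun v => -c₀ + (c₀ - c₁) * Real.log ‖v.2‖ +
    δ * (9 - ‖v.2‖ ^ 2) + N * ∑ l, logDefect A a v l ^ 2
  have hδn : ∀ v ∈ T, δ ≤ δ * (9 - ‖v.2‖ ^ 2) := by
    intro v hv
    have h1 : ‖v.2‖ ≤ Real.exp 1 :=
      (Real.log_le_iff_le_exp (norm_pos_iff.2 hv.1.1)).1 (hTx v hv).2.le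
    have h2 := Real.exp_one_lt_d9
    have h3 : ‖v.2‖ ^ 2 ≤ 8 := by nlinarith [norm_nonneg v.2]
    nlinarith
  have hSn : ∀ v, 0 ≤ N * ∑ l, logDefect A a v l ^ 2 := fun v =>
    mul_nonneg hN (Finset.sum_nonneg fun l _ => sq_nonneg _)
  have hmain : ∀ v ∈ T, u v < H v := by
    refine lt_of_strictly_supermean (isCompact_logTube hA ha hr.le) (hu.1.usc.mono hTA)
      (fun v hv => hu.1.lt_top v (hTA v hv)) ?_ fun v hv hle => ?_
    · have hlog : ContinuousOn (fun v : (Fin n → ℂ) × ℂ => Real.log ‖v.2‖) T :=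
        ContinuousOn.log (by fun_prop) fun v hv => norm_ne_zero_iff.2 hv.1.1
      exact ((continuousOn_const.add (continuousOn_const.mul hlog)).add (by fun_prop)).add
        (continuousOn_const.mul (continuousOn_finsetSum _ fun l _ =>
          (continuousOn_logDefect l).pow 2))
    · obtain ⟨p, q, hupq, hp0, hq0, hp, hq⟩ := hbound v hv
      have hHU := EReal.coe_le_coe_iff.1 (hle.trans hupq)
      simp only [H] at hHU
      have h1 := hδn v hv
      have h2 := hSn v
      obtain ⟨hxpos, hxlt⟩ := hTx v hv
      have hcp : c₀ * p ≤ 0 := mul_nonpos_of_nonneg_of_nonpos hp₀.le hp0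
      have hcq : c₁ * q ≤ 0 := mul_nonpos_of_nonneg_of_nonpos hp₁.le hq0
      have hax : ∀ l, a l * x₀ ≤ r ∧ -(a l * x₀) ≤ r := fun l => by
        have h := hx1 l
        constructor <;> nlinarith [le_abs_self (a l), neg_abs_le (a l)]
      -- On the slice `log |ζ| = x₀`, interpolation and `p ≤ -1 + e` leave `u` below `H` by at least
      -- `δ - c₁ x₀ - c₀ e > 0`, contrary to `H v ≤ u v`.
      have hlow : x₀ < Real.log ‖v.2‖ := by
        refine lt_of_le_of_ne hv.1.2.1 fun hx => ?_
        have hpe : p ≤ -1 + e := by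
          rw [← EReal.coe_le_coe_iff, ← hp]
          refine (hω₀ η hη v.1 fun l => ?_).2
          by_cases hl : v.1 l = 0
          · rw [hl, norm_zero]; positivity
          have hzl : η l ≠ 0 := fun h => hl ((hv.2 l).1.2 ((hη0 l).1 h))
          have hpos := norm_pos_iff.2 hzl
          rw [← Real.log_le_log_iff (norm_pos_iff.2 hl) (by positivity),
            Real.log_mul (Real.exp_pos _).ne' hpos.ne', Real.log_exp]
          have h3 := hupper v hv l hl
          rw [← hx] at h3
          simp only [A] at h3
          linarith [(hax l).1]
        rw [← hx] at hHU
        nlinarith [mul_le_mul_of_nonneg_left hpe hp₀.le, mul_pos hp₀ he0, mul_pos hp₁ he0,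
          mul_pos hp₀ hx0, mul_pos hp₁ hx0, mul_nonneg hx0.le (neg_nonneg.2 hcq),
          mul_pos (mul_pos hp₀ he0) hx0,
          mul_le_mul_of_nonneg_left hpe (mul_nonneg hp₀.le (by linarith : 0 ≤ 1 - x₀))]
      have hhigh : Real.log ‖v.2‖ < 1 - x₀ := by
        refine lt_of_le_of_ne hv.1.2.2 fun hx => ?_
        have hqe : q ≤ -1 + e := by
          rw [← EReal.coe_le_coe_iff, ← hq]
          refine (hω₁ ξ hξ v.1 fun l => ?_).2
          by_cases hl : v.1 l = 0
          · rw [hl, norm_zero]; positivity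
          have hzl : ξ l ≠ 0 := fun h => hl ((hv.2 l).1.2 ((hξ0 l).1 h))
          have hpos := norm_pos_iff.2 hzl
          rw [← Real.log_le_log_iff (norm_pos_iff.2 hl) (by positivity),
            Real.log_mul (Real.exp_pos _).ne' hpos.ne', Real.log_exp]
          have h3 := hupper v hv l hl
          rw [hx] at h3
          have h4 : A l + a l = Real.log ‖ξ l‖ := by simp [A, a]
          linarith [(hax l).2]
        rw [hx] at hHU
        nlinarith [mul_le_mul_of_nonneg_left hqe hp₁.le, mul_pos hp₀ he0, mul_pos hp₁ he0,
          mul_pos hp₀ hx0, mul_pos hp₁ hx0, mul_nonneg hx0.le (neg_nonneg.2 hcp),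
          mul_pos (mul_pos hp₁ he0) hx0,
          mul_le_mul_of_nonneg_left hqe (mul_nonneg hp₁.le (by linarith : 0 ≤ 1 - x₀))]
      suffices hlt : ∀ l, |logDefect A a v l| < r by
        obtain ⟨b, hb, hav⟩ := exists_disk_logTube ha hv hlow hhigh hlt (α := -c₀) (β := c₀ - c₁)
          hδ hN
        exact ⟨b, hb, hu.1.submean v b fun ζ hζ => hTA _ (hb ζ hζ), hav⟩
      intro l
      refine lt_of_le_of_ne (hv.2 l).2 fun hl => ?_
      have h3 : c₀ + c₁ ≤ N * ∑ l, logDefect A a v l ^ 2 := by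
        have h4 : logDefect A a v l ^ 2 ≤ ∑ l, logDefect A a v l ^ 2 :=
          Finset.single_le_sum (f := fun l => logDefect A a v l ^ 2)
            (fun l _ => sq_nonneg _) (Finset.mem_univ l)
        rw [← sq_abs, hl] at h4
        calc c₀ + c₁ = N * r ^ 2 := by simp only [N]; field_simp
          _ ≤ _ := mul_le_mul_of_nonneg_left h4 hN
      nlinarith [mul_nonneg hxpos.le (neg_nonneg.2 hcq),
        mul_nonneg (sub_nonneg.2 hxlt.le) (neg_nonneg.2 hcp),
        mul_pos hp₁ (sub_pos.2 hxlt), mul_pos hp₀ hxpos]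
  have hnt : ‖(Real.exp t : ℂ)‖ = Real.exp t := by
    rw [Complex.norm_real, Real.norm_of_nonneg (Real.exp_pos _).le]
  have hdef : ∀ l, logDefect A a (z, (Real.exp t : ℂ)) l = 0 := by
    intro l
    simp only [logDefect, hnt, Real.log_exp]
    by_cases hl : z l = 0
    · simp [hl, hA l hl, ha l hl]
    · have h1 : ‖η l‖ ≠ 0 := norm_ne_zero_iff.2 fun h => hl ((hη0 l).1 h)
      have h2 : ‖ξ l‖ ≠ 0 := norm_ne_zero_iff.2 fun h => hl ((hξ0 l).1 h)
      have h1' := (norm_nonneg (η l)).lt_of_ne' h1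
      have h2' := (norm_nonneg (ξ l)).lt_of_ne' h2
      rw [he l, Real.log_mul (Real.rpow_pos_of_pos h1' _).ne' (Real.rpow_pos_of_pos h2' _).ne',
        Real.log_rpow h1', Real.log_rpow h2']
      simp only [A, a]
      ring
  refine (hmain (z, (Real.exp t : ℂ)) ⟨⟨?_, ?_, ?_⟩, fun l => ⟨Iff.rfl, ?_⟩⟩).le.trans
    (EReal.coe_le_coe_iff.2 ?_)
  · exact Complex.ofReal_ne_zero.2 (Real.exp_pos t).ne'
  · simp only [hnt, Real.log_exp]
    linarith
  · simp only [hnt, Real.log_exp]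
    linarith
  · rw [hdef l, abs_zero]
    exact hr.le
  · simp only [H, hdef, hnt, Real.log_exp]
    have : 0 ≤ δ * Real.exp t ^ 2 := by positivity
    simp only [ne_eq, OfNat.ofNat_ne_zero, not_false_eq_true, zero_pow, Finset.sum_const_zero,
      mul_zero, add_zero]
    linarith

end UpperBound

/-! ### Monomial competitors and lower bounds. -/

section Competitor

variable {n : ℕ}

/-- The function `log ∏ |z_l| ^ α_l = ∑ α_l log |z_l|`. -/
noncomputable def logMonomial (α : Fin n → ℝ) (z : Fin n → ℂ) : EReal :=
  ENNReal.log (ENNReal.ofReal (∏ l, ‖z l‖ ^ α l))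

variable {α : Fin n → ℝ} {z : Fin n → ℂ}

theorem prod_norm_rpow_mul (α : Fin n → ℝ) (z : Fin n → ℂ) (c : ℝ) :
    ∏ l, ‖z l‖ ^ (c * α l) = (∏ l, ‖z l‖ ^ α l) ^ c := by
  rw [← Real.finsetProd_rpow _ _ fun l _ => Real.rpow_nonneg (norm_nonneg _) _]
  refine Finset.prod_congr rfl fun l _ => ?_
  rw [mul_comm, Real.rpow_mul (norm_nonneg _)]

theorem prod_norm_rpow_nonneg (α : Fin n → ℝ) (z : Fin n → ℂ) : 0 ≤ ∏ l, ‖z l‖ ^ α l :=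
  Finset.prod_nonneg fun _ _ => Real.rpow_nonneg (norm_nonneg _) _

theorem prod_norm_rpow_eq_exp (h : ∀ l, z l ≠ 0 ∨ α l = 0) :
    ∏ l, ‖z l‖ ^ α l = Real.exp (∑ l, Real.log ‖z l‖ * α l) := by
  rw [Real.exp_sum]
  refine Finset.prod_congr rfl fun l _ => ?_
  rcases h l with h | h
  · rw [Real.rpow_def_of_pos (norm_pos_iff.2 h)]
  · simp [h]

theorem logMonomial_le {B : ℝ} (h : ∏ l, ‖z l‖ ^ α l ≤ Real.exp B) : logMonomial α z ≤ B := by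
  calc logMonomial α z ≤ ENNReal.log (ENNReal.ofReal (Real.exp B)) :=
        ENNReal.log_monotone (ENNReal.ofReal_le_ofReal h)
    _ = B := by rw [ENNReal.log_ofReal_of_pos (Real.exp_pos B), Real.log_exp]

theorem logMonomial_le_zero (hα : ∀ l, 0 ≤ α l) (hz : z ∈ unitPolydisk n) :
    logMonomial α z ≤ 0 := by
  refine logMonomial_le (B := 0) ?_
  rw [Real.exp_zero]
  exact Finset.prod_le_one (fun l _ => Real.rpow_nonneg (norm_nonneg _) _) fun l _ =>
    Real.rpow_le_one (norm_nonneg _) (hz l).le (hα l)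

/-- The function `c⁻¹ (log ∏ |z_l|^{α_l} - A) - 1` belongs to the extremal class; the hypothesis `-A
≤ c` is what makes it nonpositive on the polydisk. -/
theorem logMonomial_add_le_mul_relExtremal {K : Set (Fin n → ℂ)} (hα : ∀ l, 0 ≤ α l) {A c : ℝ}
    (hc : 0 < c) (hA : -A ≤ c) (hK : ∀ η ∈ K, ∏ l, ‖η l‖ ^ α l ≤ Real.exp A)
    (hz : z ∈ unitPolydisk n) :
    logMonomial α z + ((-A - c : ℝ) : EReal) ≤ c * relExtremal (unitPolydisk n) K z := by
  have hα' : ∀ l, 0 ≤ c⁻¹ * α l := fun l => mul_nonneg (inv_nonneg.2 hc.le) (hα l)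
  have hcls : (fun y => logMonomial (fun l => c⁻¹ * α l) y + ((-(c⁻¹ * A) - 1 : ℝ) : EReal)) ∈
      extremalClass (unitPolydisk n) K := by
    refine ⟨?_, fun y hy => ?_, fun y hy => ?_⟩
    · have := isPlurisubharmonicOn_log_prod (E := Fin n → ℂ)
        (fun l => ContinuousLinearMap.proj (R := ℂ) (φ := fun _ : Fin n => ℂ) l) hα' 0
        (-(c⁻¹ * A) - 1) 0 (U := unitPolydisk n) (Or.inl rfl)
      simpa [logMonomial] using this
    · have h1 : c⁻¹ * -A ≤ 1 := by rwa [inv_mul_le_iff₀ hc, mul_one]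
      calc _ ≤ (0 : EReal) + ((0 : ℝ) : EReal) := add_le_add (logMonomial_le_zero hα' hy)
            (EReal.coe_le_coe_iff.2 (by linarith))
        _ = 0 := by simp
    · have h1 : logMonomial (fun l => c⁻¹ * α l) y ≤ ((c⁻¹ * A : ℝ) : EReal) := by
        apply logMonomial_le
        rw [prod_norm_rpow_mul, mul_comm c⁻¹ A, Real.exp_mul]
        exact Real.rpow_le_rpow (prod_norm_rpow_nonneg _ _) (hK y hy) (inv_nonneg.2 hc.le)
      calc _ ≤ ((c⁻¹ * A : ℝ) : EReal) + ((-(c⁻¹ * A) - 1 : ℝ) : EReal) := add_le_add_left h1 _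
        _ = ((-1 : ℝ) : EReal) := by rw [← EReal.coe_add]; congr 1; ring
        _ = -1 := by simp
  obtain ⟨r, hr, -, -⟩ := exists_coe_eq_relExtremal (K := K) hz
  have hle := le_relExtremal hcls hz
  rw [hr] at hle ⊢
  rcases (prod_norm_rpow_nonneg α z).eq_or_lt with h0 | hpos
  · simp [logMonomial, ← h0]
  · have hl1 : logMonomial α z = (Real.log (∏ l, ‖z l‖ ^ α l) : ℝ) :=
      ENNReal.log_ofReal_of_pos hpos
    have hl2 : logMonomial (fun l => c⁻¹ * α l) z =
        ((c⁻¹ * Real.log (∏ l, ‖z l‖ ^ α l) : ℝ) : EReal) := by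
      rw [logMonomial, prod_norm_rpow_mul, ENNReal.log_ofReal_of_pos (Real.rpow_pos_of_pos hpos _),
        Real.log_rpow hpos]
    rw [hl2, ← EReal.coe_add, EReal.coe_le_coe_iff] at hle
    rw [hl1, ← EReal.coe_add, ← EReal.coe_mul, EReal.coe_le_coe_iff]
    have h2 := mul_le_mul_of_nonneg_left hle hc.le
    have h3 : c * (c⁻¹ * Real.log (∏ l, ‖z l‖ ^ α l) + (-(c⁻¹ * A) - 1)) =
        Real.log (∏ l, ‖z l‖ ^ α l) + (-A - c) := by field_simp
    linarith

theorem limsup_add_log_norm_le (x : EReal) (p q j : ℝ) :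
    limsup (fun ζ : ℂ => x + ((p + q * Real.log ‖ζ‖ : ℝ) : EReal))
      (𝓝ˢ (boundaryCircle j) ⊓ 𝓟 annulus) ≤ x + ((p + q * j : ℝ) : EReal) := by
  rcases (𝓝ˢ (boundaryCircle j) ⊓ 𝓟 annulus).eq_or_neBot with h | h
  · simp [h]
  refine Tendsto.limsup_eq ?_ |>.le
  have hlog : Tendsto (fun ζ : ℂ => Real.log ‖ζ‖) (𝓝ˢ (boundaryCircle j) ⊓ 𝓟 annulus) (𝓝 j) := by
    refine Tendsto.mono_left (fun V hV => mem_nhdsSet_iff_forall.2 fun ζ hζ => ?_) inf_le_left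
    have hc : ContinuousAt (fun ζ : ℂ => Real.log ‖ζ‖) ζ :=
      continuous_norm.continuousAt.log (norm_ne_zero_iff.2 hζ.1)
    exact hc (by simpa only [hζ.2] using hV)
  have h1 : Tendsto (fun ζ : ℂ => ((p + q * Real.log ‖ζ‖ : ℝ) : EReal))
      (𝓝ˢ (boundaryCircle j) ⊓ 𝓟 annulus) (𝓝 ((p + q * j : ℝ) : EReal)) :=
    (continuous_coe_real_ereal.tendsto _).comp (tendsto_const_nhds.add (tendsto_const_nhds.mul hlog))
  exact (EReal.continuousAt_add (p := (x, ((p + q * j : ℝ) : EReal)))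
    (Or.inr (EReal.coe_ne_bot _)) (Or.inr (EReal.coe_ne_top _))).tendsto.comp
      (tendsto_const_nhds.prodMk_nhds h1)

theorem le_weightedGeodesic {K₀ K₁ : Set (Fin n → ℂ)} (hα : ∀ l, 0 ≤ α l) {A₀ A₁ c₀ c₁ t : ℝ}
    (hp₀ : 0 < c₀) (hp₁ : 0 < c₁) (hA₀ : -A₀ ≤ c₀) (hA₁ : -A₁ ≤ c₁)
    (hK₀ : ∀ η ∈ K₀, ∏ l, ‖η l‖ ^ α l ≤ Real.exp A₀)
    (hK₁ : ∀ η ∈ K₁, ∏ l, ‖η l‖ ^ α l ≤ Real.exp A₁) (z : Fin n → ℂ) :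
    logMonomial α z + (((1 - t) * (-A₀ - c₀) + t * (-A₁ - c₁) : ℝ) : EReal) ≤
      weightedGeodesic (unitPolydisk n) K₀ K₁ c₀ c₁ t z := by
  obtain ⟨p, hp⟩ : ∃ p, p = -A₀ - c₀ := ⟨_, rfl⟩
  obtain ⟨q, hq⟩ : ∃ q, q = -A₁ - c₁ - p := ⟨_, rfl⟩
  let w : (Fin n → ℂ) × ℂ → EReal := fun v =>
    logMonomial α v.1 + ((p + q * Real.log ‖v.2‖ : ℝ) : EReal)
  have hw : w ∈ geodesicClass (unitPolydisk n)
      (fun z => (c₀ : EReal) * relExtremal (unitPolydisk n) K₀ z)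
      (fun z => (c₁ : EReal) * relExtremal (unitPolydisk n) K₁ z) := by
    refine ⟨?_, fun y hy => ?_, fun y hy => ?_⟩
    · have := isPlurisubharmonicOn_log_prod (E := (Fin n → ℂ) × ℂ)
        (fun l => (ContinuousLinearMap.proj (R := ℂ) (φ := fun _ : Fin n => ℂ) l).comp
          (ContinuousLinearMap.fst ℂ (Fin n → ℂ) ℂ)) hα
        (ContinuousLinearMap.snd ℂ (Fin n → ℂ) ℂ) p q (U := unitPolydisk n ×ˢ annulus)
        (Or.inr fun v hv => hv.2.1)
      simpa only [w, logMonomial, ContinuousLinearMap.comp_apply, ContinuousLinearMap.coe_fst',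
        ContinuousLinearMap.coe_snd', ContinuousLinearMap.proj_apply] using this
    · refine (limsup_add_log_norm_le (logMonomial α y) p q 0).trans ?_
      rw [mul_zero, add_zero, hp]
      exact logMonomial_add_le_mul_relExtremal hα hp₀ hA₀ hK₀ hy
    · refine (limsup_add_log_norm_le (logMonomial α y) p q 1).trans ?_
      have : p + q * 1 = -A₁ - c₁ := by rw [hq]; ring
      rw [this]
      exact logMonomial_add_le_mul_relExtremal hα hp₁ hA₁ hK₁ hy
  refine le_trans (le_of_eq ?_) (le_iSup₂ (f := fun u (_ : u ∈ geodesicClass (unitPolydisk n)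
      (fun z => (c₀ : EReal) * relExtremal (unitPolydisk n) K₀ z)
      (fun z => (c₁ : EReal) * relExtremal (unitPolydisk n) K₁ z)) =>
        u (z, (Real.exp t : ℂ))) w hw)
  simp only [w, Complex.norm_real, Real.norm_of_nonneg (Real.exp_pos t).le, Real.log_exp]
  congr 2
  rw [hq, hp]
  ring

end Competitor

/-! ### Separation in logarithmic coordinates. -/

section Separation

variable {n : ℕ} {K₀ K₁ : Set (Fin n → ℂ)} {t : ℝ}

theorem nonneg_of_forall_sub_mul_lt {c b d : ℝ} (h : ∀ k : ℝ, 0 ≤ k → c - k * b < d) : 0 ≤ b := by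
  by_contra! hb
  have h1 := h (max 0 ((d - c) / -b)) (le_max_left _ _)
  have h2 : d - c ≤ max 0 ((d - c) / -b) * -b := by
    rw [← div_le_iff₀ (by linarith)]
    exact le_max_right _ _
  linarith

/-- A monomial separating a point from the geometric mean, in logarithmic scale. -/
theorem exists_separating_monomial
    (hc₀ : IsCompact K₀) (hc₁ : IsCompact K₁)
    (hs₀ : K₀ ⊆ unitPolydisk n) (hs₁ : K₁ ⊆ unitPolydisk n)
    (hR₀ : IsReinhardt K₀) (hR₁ : IsReinhardt K₁)
    (h₀ : IsCompleteLogConvex K₀) (h₁ : IsCompleteLogConvex K₁)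
    (hne₀ : K₀.Nonempty) (hne₁ : K₁.Nonempty) (ht0 : 0 < t) (ht1 : t < 1)
    {z : Fin n → ℂ} (hz : z ∉ geometricMean K₀ K₁ t) :
    ∃ (α : Fin n → ℝ) (A₀ A₁ : ℝ), (∀ l, 0 ≤ α l) ∧
      (∀ η ∈ K₀, ∏ l, ‖η l‖ ^ α l ≤ Real.exp A₀) ∧ (∀ η ∈ K₁, ∏ l, ‖η l‖ ^ α l ≤ Real.exp A₁) ∧
      Real.exp ((1 - t) * A₀ + t * A₁) < ∏ l, ‖z l‖ ^ α l := by
  classical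
  -- Coordinates where `z` vanishes are collapsed to `0`: the separating functional then cannot
  -- depend on them, and `z` needs no logarithm there.
  let E : (Fin n → ℝ) → Fin n → ℂ := fun s l => if z l = 0 then 0 else (Real.exp (s l) : ℂ)
  have hE : ∀ s l, ‖E s l‖ = if z l = 0 then 0 else Real.exp (s l) := by
    intro s l
    simp only [E]
    split_ifs
    · simp
    · rw [Complex.norm_real, Real.norm_of_nonneg (Real.exp_pos _).le]
  have hEc : Continuous E := by
    refine continuous_pi fun l => ?_
    by_cases hl : z l = 0
    · simp only [E, hl, if_true]
      exact continuous_const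
    · simp only [E, hl, if_false]
      fun_prop
  have hle : ∀ {y w : Fin n → ℂ}, y ∈ geometricMean K₀ K₁ t → (∀ l, ‖w l‖ ≤ ‖y l‖) →
      w ∈ geometricMean K₀ K₁ t := fun hy h =>
    mem_geometricMean_of_norm_le h₀ hc₀.isClosed hs₀ hR₀ h₁ hc₁.isClosed hs₁ hR₁ hy h
  let Q : Set (Fin n → ℝ) := E ⁻¹' geometricMean K₀ K₁ t
  have hQc : IsClosed Q := (isClosed_geometricMean hc₀ hc₁ ht0 ht1).preimage hEc
  have hQconv : Convex ℝ Q := by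
    refine convex_iff_forall_pos.2 fun s hs s' hs' a b ha hb hab => ?_
    refine mem_geometricMean_of_norm_eq_mul h₀ hc₀.isClosed hs₀ hR₀ h₁ hc₁.isClosed hs₁ hR₁ hs hs'
      ha hb hab fun l => ?_
    rw [hE, hE, hE]
    split_ifs
    · simp [Real.zero_rpow ha.ne']
    · rw [← Real.exp_mul, ← Real.exp_mul, ← Real.exp_add]
      simp [mul_comm]
  let sz : Fin n → ℝ := fun l => Real.log ‖z l‖
  have hsz : sz ∉ Q := by
    refine fun h => hz (hle h fun l => ?_)
    rw [hE]
    split_ifs with hl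
    · simp [hl]
    · rw [Real.exp_log (norm_pos_iff.2 hl)]
  obtain ⟨f, d, hfd, hdz⟩ := geometric_hahn_banach_closed_point hQconv hQc hsz
  let α : Fin n → ℝ := fun l => f (Pi.single l 1)
  have hf : ∀ s : Fin n → ℝ, f s = ∑ l, s l * α l := fun s => by
    have h1 := LinearMap.pi_apply_eq_sum_univ f.toLinearMap s
    simp only [ContinuousLinearMap.coe_coe, smul_eq_mul] at h1
    rw [h1]
    refine Finset.sum_congr rfl fun l _ => ?_
    congr 2
    ext i
    simp [Pi.single_apply, eq_comm]
  have hQmem : ∀ η ∈ K₀, (∀ l, η l ≠ 0) → ∀ ξ ∈ K₁, (∀ l, ξ l ≠ 0) →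
      ((1 - t) • fun l => Real.log ‖η l‖) + (t • fun l => Real.log ‖ξ l‖) ∈ Q := by
    intro η hη hη0 ξ hξ hξ0
    have hn : ∀ l, ‖((‖η l‖ ^ (1 - t) * ‖ξ l‖ ^ t : ℝ) : ℂ)‖ = ‖η l‖ ^ (1 - t) * ‖ξ l‖ ^ t :=
      fun l => by rw [Complex.norm_real, Real.norm_of_nonneg (by positivity)]
    refine hle (y := fun l => ((‖η l‖ ^ (1 - t) * ‖ξ l‖ ^ t : ℝ) : ℂ))
      ⟨η, hη, ξ, hξ, hn⟩ fun l => ?_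
    rw [hE, hn]
    split_ifs
    · positivity
    · rw [Real.rpow_def_of_pos (norm_pos_iff.2 (hη0 l)),
        Real.rpow_def_of_pos (norm_pos_iff.2 (hξ0 l)), ← Real.exp_add]
      simp [mul_comm]
  have hex : ∀ K : Set (Fin n → ℂ), IsCompleteLogConvex K → K.Nonempty →
      ∃ η, η ∈ K ∧ ∀ l, η l ≠ 0 := fun K hK hne => by
    obtain ⟨η, hη⟩ := hne
    exact closure_nonempty_iff.1 ⟨η, hK.dense hη⟩
  obtain ⟨η, hη, hη0⟩ := hex K₀ h₀ hne₀
  obtain ⟨ξ, hξ, hξ0⟩ := hex K₁ h₁ hne₁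
  set s₁ := ((1 - t) • fun l => Real.log ‖η l‖) + (t • fun l => Real.log ‖ξ l‖)
  have hs₁Q : s₁ ∈ Q := hQmem η hη hη0 ξ hξ hξ0
  -- The set `Q` is stable under lowering coordinates, and `f` is bounded above on it.
  have hα : ∀ l, 0 ≤ α l := by
    intro l
    refine nonneg_of_forall_sub_mul_lt (c := f s₁) (d := d) fun k hk => ?_
    have h1 : s₁ - k • Pi.single l 1 ∈ Q := by
      refine hle hs₁Q fun i => ?_
      rw [hE, hE]
      split_ifs
      · exact le_rfl
      · refine Real.exp_le_exp.2 ?_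
        simp only [Pi.sub_apply, Pi.smul_apply, smul_eq_mul, tsub_le_iff_right,
          le_add_iff_nonneg_right]
        exact mul_nonneg hk (by by_cases h : i = l <;> simp [h])
    have h2 := hfd _ h1
    rwa [map_sub, map_smul, smul_eq_mul] at h2
  -- `Q` is invariant under translation in such a coordinate, also upwards, so the bound on `f`
  -- forces the coefficient to vanish.
  have hα0 : ∀ l, z l = 0 → α l = 0 := by
    intro l hl
    refine le_antisymm (neg_nonneg.1 ?_) (hα l)
    refine nonneg_of_forall_sub_mul_lt (c := f s₁) (d := d) fun k hk => ?_
    have h1 : s₁ + k • Pi.single l 1 ∈ Q := by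
      refine hle hs₁Q fun i => ?_
      rw [hE, hE]
      split_ifs with hi
      · exact le_rfl
      · have : i ≠ l := fun h => hi (h ▸ hl)
        simp [this]
    have h2 := hfd _ h1
    rw [map_add, map_smul, smul_eq_mul] at h2
    simp only [α] at h2 ⊢
    linarith
  -- The supremum is taken over points without zero coordinates, where `log` is meaningful; density
  -- carries the bound on the monomial to all of `K`.
  let S : Set (Fin n → ℂ) → Set ℝ := fun K =>
    (fun η : Fin n → ℂ => ∑ l, Real.log ‖η l‖ * α l) '' {η | η ∈ K ∧ ∀ l, η l ≠ 0}
  have hSbdd : ∀ K : Set (Fin n → ℂ), K ⊆ unitPolydisk n → BddAbove (S K) := by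
    rintro K hK
    refine ⟨0, ?_⟩
    rintro - ⟨η, ⟨hη, -⟩, rfl⟩
    exact Finset.sum_nonpos fun l _ => mul_nonpos_of_nonpos_of_nonneg
      (Real.log_nonpos (norm_nonneg _) (hK hη l).le) (hα l)
  have hprod : ∀ K : Set (Fin n → ℂ), IsCompleteLogConvex K → K ⊆ unitPolydisk n →
      ∀ η ∈ K, ∏ l, ‖η l‖ ^ α l ≤ Real.exp (sSup (S K)) := by
    intro K hK hs η hη
    have hcont : Continuous fun η : Fin n → ℂ => ∏ l, ‖η l‖ ^ α l :=
      continuous_finsetProd _ fun l _ =>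
        Continuous.rpow_const (by fun_prop) fun _ => Or.inr (hα l)
    refine closure_minimal (t := {η : Fin n → ℂ | ∏ l, ‖η l‖ ^ α l ≤ Real.exp (sSup (S K))})
      (fun y hy => ?_) (isClosed_le hcont continuous_const) (hK.dense hη)
    rw [mem_ofPred_eq, prod_norm_rpow_eq_exp fun l => Or.inl (hy.2 l)]
    exact Real.exp_le_exp.2 (le_csSup (hSbdd K hs) ⟨y, hy, rfl⟩)
  -- The points of `K₀` and `K₁` vary independently, so the two suprema may be taken one after the
  -- other.
  have hsup : (1 - t) * sSup (S K₀) + t * sSup (S K₁) ≤ d := by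
    have h1 : ∀ p ∈ S K₀, ∀ q ∈ S K₁, (1 - t) * p + t * q ≤ d := by
      rintro - ⟨y, ⟨hy, hy0⟩, rfl⟩ - ⟨y', ⟨hy', hy0'⟩, rfl⟩
      have := hfd _ (hQmem y hy hy0 y' hy' hy0')
      rw [map_add, map_smul, map_smul, hf, hf] at this
      exact this.le
    have h2 : ∀ p ∈ S K₀, sSup (S K₁) ≤ (d - (1 - t) * p) / t := fun p hp =>
      csSup_le ⟨_, ξ, ⟨hξ, hξ0⟩, rfl⟩ fun q hq => by
        rw [le_div_iff₀ ht0]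
        linarith [h1 p hp q hq]
    have h3 : sSup (S K₀) ≤ (d - t * sSup (S K₁)) / (1 - t) :=
      csSup_le ⟨_, η, ⟨hη, hη0⟩, rfl⟩ fun p hp => by
        have := h2 p hp
        rw [le_div_iff₀ ht0] at this
        rw [le_div_iff₀ (by linarith)]
        linarith
    rw [le_div_iff₀ (by linarith)] at h3
    linarith
  refine ⟨α, sSup (S K₀), sSup (S K₁), hα, hprod K₀ h₀ hs₀, hprod K₁ h₁ hs₁, ?_⟩
  rw [prod_norm_rpow_eq_exp fun l => or_iff_not_imp_left.2 fun h => hα0 l (not_not.1 h)]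
  refine Real.exp_lt_exp.2 (hsup.trans_lt ?_)
  rwa [hf] at hdz

end Separation

/-! ### Identification of the minimum set. -/

section Main

variable {n : ℕ} {K₀ K₁ : Set (Fin n → ℂ)} {c₀ c₁ t : ℝ}

theorem coe_le_weightedGeodesic
    (hp₀ : 0 < c₀) (hp₁ : 0 < c₁) (z : Fin n → ℂ) :
    ((-((1 - t) * c₀ + t * c₁) : ℝ) : EReal) ≤
      weightedGeodesic (unitPolydisk n) K₀ K₁ c₀ c₁ t z := by
  have h := le_weightedGeodesic (α := fun _ => 0) (K₀ := K₀) (K₁ := K₁) (A₀ := 0) (A₁ := 0)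
    (t := t) (fun _ => le_rfl) hp₀ hp₁ (by linarith) (by linarith) (by simp) (by simp) z
  refine le_trans (le_of_eq ?_) h
  simp only [logMonomial, Real.rpow_zero, Finset.prod_const_one, ENNReal.ofReal_one,
    ENNReal.log_one, zero_add]
  congr 1
  ring

theorem coe_lt_weightedGeodesic
    (hc₀ : IsCompact K₀) (hc₁ : IsCompact K₁)
    (hs₀ : K₀ ⊆ unitPolydisk n) (hs₁ : K₁ ⊆ unitPolydisk n)
    (hR₀ : IsReinhardt K₀) (hR₁ : IsReinhardt K₁)
    (h₀ : IsCompleteLogConvex K₀) (h₁ : IsCompleteLogConvex K₁)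
    (hne₀ : K₀.Nonempty) (hne₁ : K₁.Nonempty) (hp₀ : 0 < c₀) (hp₁ : 0 < c₁)
    (ht0 : 0 < t) (ht1 : t < 1) {z : Fin n → ℂ} (hz : z ∉ geometricMean K₀ K₁ t) :
    ((-((1 - t) * c₀ + t * c₁) : ℝ) : EReal) <
      weightedGeodesic (unitPolydisk n) K₀ K₁ c₀ c₁ t z := by
  obtain ⟨α, A₀, A₁, hα, hA₀, hA₁, hlt⟩ := exists_separating_monomial hc₀ hc₁ hs₀ hs₁ hR₀ hR₁ h₀ h₁
    hne₀ hne₁ ht0 ht1 hz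
  have hden : 0 < 1 + |A₀| + |A₁| := by positivity
  -- Multiplying `α`, `A₀` and `A₁` by a small `c` preserves strict separation and secures `-c A_j ≤
  -- c_j`, whatever the weights are.
  obtain ⟨c, hc, hcc₀, hcc₁⟩ : ∃ c > 0, c * |A₀| ≤ c₀ ∧ c * |A₁| ≤ c₁ := by
    refine ⟨min c₀ c₁ / (1 + |A₀| + |A₁|), by positivity, ?_, ?_⟩
    · rw [div_mul_eq_mul_div, div_le_iff₀ hden]
      have := min_le_left c₀ c₁
      nlinarith [abs_nonneg A₀, abs_nonneg A₁, mul_le_mul_of_nonneg_right this (abs_nonneg A₀),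
        mul_nonneg hp₀.le (abs_nonneg A₁)]
    · rw [div_mul_eq_mul_div, div_le_iff₀ hden]
      have := min_le_right c₀ c₁
      nlinarith [abs_nonneg A₀, abs_nonneg A₁, mul_le_mul_of_nonneg_right this (abs_nonneg A₁),
        mul_nonneg hp₁.le (abs_nonneg A₀)]
  have hscale : ∀ {K : Set (Fin n → ℂ)} {A : ℝ}, (∀ η ∈ K, ∏ l, ‖η l‖ ^ α l ≤ Real.exp A) →
      ∀ η ∈ K, ∏ l, ‖η l‖ ^ (c * α l) ≤ Real.exp (c * A) := fun h η hη => by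
    rw [prod_norm_rpow_mul, mul_comm c, Real.exp_mul]
    exact Real.rpow_le_rpow (prod_norm_rpow_nonneg _ _) (h η hη) hc.le
  have h := le_weightedGeodesic (α := fun l => c * α l) (t := t) (fun l => mul_nonneg hc.le (hα l))
    hp₀ hp₁ (A₀ := c * A₀) (A₁ := c * A₁)
    (by rw [← mul_neg]; exact (mul_le_mul_of_nonneg_left (neg_le_abs A₀) hc.le).trans hcc₀)
    (by rw [← mul_neg]; exact (mul_le_mul_of_nonneg_left (neg_le_abs A₁) hc.le).trans hcc₁)
    (hscale hA₀) (hscale hA₁) z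
  refine lt_of_lt_of_le ?_ h
  have hpos : 0 < ∏ l, ‖z l‖ ^ α l := (Real.exp_pos _).trans hlt
  have hlog : (1 - t) * A₀ + t * A₁ < Real.log (∏ l, ‖z l‖ ^ α l) :=
    (Real.lt_log_iff_exp_lt hpos).2 hlt
  rw [logMonomial, prod_norm_rpow_mul, ENNReal.log_ofReal_of_pos (Real.rpow_pos_of_pos hpos _),
    Real.log_rpow hpos, ← EReal.coe_add, EReal.coe_lt_coe_iff]
  nlinarith [mul_lt_mul_of_pos_left hlog hc]

theorem interpolatingSet_eq_geometricMean
    (hc₀ : IsCompact K₀) (hc₁ : IsCompact K₁)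
    (hs₀ : K₀ ⊆ unitPolydisk n) (hs₁ : K₁ ⊆ unitPolydisk n)
    (hR₀ : IsReinhardt K₀) (hR₁ : IsReinhardt K₁)
    (h₀ : IsCompleteLogConvex K₀) (h₁ : IsCompleteLogConvex K₁)
    (hne₀ : K₀.Nonempty) (hne₁ : K₁.Nonempty) (hp₀ : 0 < c₀) (hp₁ : 0 < c₁)
    (ht0 : 0 < t) (ht1 : t < 1) :
    interpolatingSet (unitPolydisk n) K₀ K₁ c₀ c₁ t = geometricMean K₀ K₁ t := by
  have hsub := geometricMean_subset_unitPolydisk hs₀ hs₁ ht0 ht1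
  have heq : ∀ z ∈ geometricMean K₀ K₁ t, weightedGeodesic (unitPolydisk n) K₀ K₁ c₀ c₁ t z =
      ((-((1 - t) * c₀ + t * c₁) : ℝ) : EReal) := fun z hz =>
    le_antisymm (iSup₂_le fun u hu => le_of_mem_geodesicClass_of_mem_geometricMean hc₀ hc₁ hs₀ hs₁
      hR₀ hR₁ h₀ h₁ hp₀ hp₁ ht0 ht1 hu hz) (coe_le_weightedGeodesic hp₀ hp₁ z)
  have hinf : (⨅ w ∈ unitPolydisk n, weightedGeodesic (unitPolydisk n) K₀ K₁ c₀ c₁ t w) =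
      ((-((1 - t) * c₀ + t * c₁) : ℝ) : EReal) := by
    obtain ⟨η, hη⟩ := hne₀
    obtain ⟨ξ, hξ⟩ := hne₁
    have hz : (fun l => ((‖η l‖ ^ (1 - t) * ‖ξ l‖ ^ t : ℝ) : ℂ)) ∈ geometricMean K₀ K₁ t :=
      ⟨η, hη, ξ, hξ, fun l => by rw [Complex.norm_real, Real.norm_of_nonneg (by positivity)]⟩
    exact le_antisymm ((iInf₂_le _ (hsub hz)).trans_eq (heq _ hz))
      (le_iInf₂ fun z _ => coe_le_weightedGeodesic hp₀ hp₁ z)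
  ext z
  constructor
  · rintro ⟨-, hz⟩
    by_contra hmem
    rw [hinf] at hz
    exact (coe_lt_weightedGeodesic hc₀ hc₁ hs₀ hs₁ hR₀ hR₁ h₀ h₁ hne₀ hne₁ hp₀ hp₁ ht0 ht1
      hmem).ne' hz
  · exact fun hz => ⟨hsub hz, by rw [hinf, heq z hz]⟩

end Main

theorem theorem2 (n : ℕ) (hn : 0 < n) (K₀ K₁ : Set (Fin n → ℂ))
    (hK₀_compact : IsCompact K₀) (hK₁_compact : IsCompact K₁)
    (hK₀_subset : K₀ ⊆ unitPolydisk n) (hK₁_subset : K₁ ⊆ unitPolydisk n)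
    (hK₀_reinhardt : IsReinhardt K₀) (hK₁_reinhardt : IsReinhardt K₁)
    (hK₀_convex : IsCompleteLogConvex K₀) (hK₁_convex : IsCompleteLogConvex K₁)
    (hK₀_nonpluripolar : ¬ IsPluripolar K₀) (hK₁_nonpluripolar : ¬ IsPluripolar K₁) :
    (∀ c₀ c₁ : ℝ, 0 < c₀ → 0 < c₁ → ∀ t ∈ Set.Ioo (0 : ℝ) 1,
      interpolatingSet (unitPolydisk n) K₀ K₁ c₀ c₁ t = geometricMean K₀ K₁ t) ∧
    (∀ c₀ c₁ d₀ d₁ : ℝ, 0 < c₀ → 0 < c₁ → 0 < d₀ → 0 < d₁ → ∀ t ∈ Set.Ioo (0 : ℝ) 1,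
      interpolatingSet (unitPolydisk n) K₀ K₁ c₀ c₁ t =
        interpolatingSet (unitPolydisk n) K₀ K₁ d₀ d₁ t) := by
  have hne₀ := nonempty_of_not_isPluripolar hK₀_nonpluripolar
  have hne₁ := nonempty_of_not_isPluripolar hK₁_nonpluripolar
  have key : ∀ c₀ c₁ : ℝ, 0 < c₀ → 0 < c₁ → ∀ t ∈ Set.Ioo (0 : ℝ) 1,
      interpolatingSet (unitPolydisk n) K₀ K₁ c₀ c₁ t = geometricMean K₀ K₁ t :=
    fun c₀ c₁ hp₀ hp₁ t ht => interpolatingSet_eq_geometricMean hK₀_compact hK₁_compact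
      hK₀_subset hK₁_subset hK₀_reinhardt hK₁_reinhardt hK₀_convex hK₁_convex hne₀ hne₁ hp₀ hp₁
      ht.1 ht.2
  exact ⟨key, fun c₀ c₁ d₀ d₁ hc₀ hc₁ hd₀ hd₁ t ht => by
    rw [key c₀ c₁ hc₀ hc₁ t ht, key d₀ d₁ hd₀ hd₁ t ht]⟩
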